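/- Let $k\ge 0$, let $S_k$ be the symmetric group with its Bruhat order, and let $w_0\in S_k$ be the longest permutation. Let $\mathcal{F}\ell_k=\mathrm{GL}_k(\mathbb{C})/\mathsf{B}$ be the variety of complete flags in $\mathbb{C}^k$, where $\mathsf B$ is the group of invertible upper triangular matrices. For $w\in S_k$ let $\mathcal{F}(w)$ be the coordinate flag whose $i$-th term is $\langle e_{w(1)},\dots,e_{w(i)}\rangle$, and put $\mathcal{F}^{\mathrm{std}}=\mathcal{F}(e)$, $\mathcal{F}^{\mathrm{ant}}=\mathcal{F}(w_0)$. Write $\mathcal{F}\xrightarrow{w}\mathcal{F}'$ if there is $g\in \mathrm{GL}_k(\mathbb{C})$ with $g\mathcal{F}=\mathcal{F}^{\mathrm{std}}$ and $g\mathcal{F}'=\mathcal{F}(w)$. The open Richardson variety of $u,w\in S_k$ is the locally closed subvariety $$R(u,w)=\{\mathcal{F}\in\mathcal{F}\ell_k \mid \mathcal{F}^{\mathrm{std}}\xrightarrow{w}\mathcal{F}\xrightarrow{u^{-1}w_0}\mathcal{F}^{\mathrm{ant}}\}.$$ A splicing map for $u,v,w\in S_k$ is an open embedding $R(u,v)\times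 R(v,w)\hookrightarrow R(u,w)$ with image $\{\mathcal{F}\in R(u,w)\mid \mathcal{F}\xrightarrow{w_0}\mathcal{F}(vw_0)\}$. **Corollary.** Let $u=v_0<v_1<\dots<v_\ell=w$ be a maximal chain from $u$ to $w$ in the Bruhat order on $S_k$. Then each $R(v_{i-1},v_i)$ is isomorphic to $\mathbb{C}^\times$, the product of such isomorphisms is an isomorphism of algebraic varieties $$(\mathbb{C}^\times)^\ell\;\cong\;R(v_0,v_1)\times R(v_1,v_2)\times\cdots\times R(v_{\ell-1},v_\ell),$$ and there is an open embedding of algebraic varieties $$\psi: R(v_0,v_1)\times R(v_1,v_2)\times\cdots\times R(v_{\ell-1},v_\ell)\hookrightarrow R(u,w).$$ Moreover $\psi$ can be taken to be an iteration of splicing maps along the chain: there are splicing maps $\Psi_i: R(v_0,v_i)\times R(v_i,v_{i+1})\hookrightarrow R(v_0,v_{i+1})$ for $0\le i<\ell$ such that $\psi(p_0,\dots,p_{\ell-1})=G_\ell$, where $G_0$ is the unique point of $R(v_0,v_0)$ and $G_{i+1}=\Psi_i(G_i,p_i)$. -/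

import Mathlib

open Filter Topology

/-! ### Spaces with functions

Classical complex varieties are treated as spaces with functions: a (Zariski) topology together
with a sheaf of `ℂ`-algebras of `ℂ`-valued functions in which a nonvanishing regular function is
invertible.  A subsheaf of the sheaf of all functions is recorded by its germs: `RegAt x f` says
that `f` is regular in a neighbourhood of `x`, and `f` is a section over an open set `U` when it is
regular at every point of `U`. -/

structure SpaceWithFunctions (X : Type*) where
  top : TopologicalSpace X
  RegAt : X → (X → ℂ) → Prop
  congr' : ∀ x f g, f =ᶠ[@nhds X top x] g → RegAt x f → RegAt x g
  eventually' : ∀ x f, RegAt x f → ∀ᶠ y in @nhds X top x, RegAt y f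
  const' : ∀ x (c : ℂ), RegAt x (fun _ => c)
  add' : ∀ x f g, RegAt x f → RegAt x g → RegAt x (f + g)
  mul' : ∀ x f g, RegAt x f → RegAt x g → RegAt x (f * g)
  inv' : ∀ x f, RegAt x f → f x ≠ 0 → (∀ᶠ y in @nhds X top x, f y ≠ 0) ∧ RegAt x f⁻¹

namespace SpaceWithFunctions

variable {X Y : Type*}

/-- Openness for the topology of a space with functions. -/
def Open (S : SpaceWithFunctions X) (U : Set X) : Prop := @IsOpen X S.top U

/-- `f` is a regular function on `U`. -/
def RegOn (S : SpaceWithFunctions X) (U : Set X) (f : X → ℂ) : Prop := ∀ x ∈ U, S.RegAt x f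

/-- Affine space: the Zariski topology, whose basic open sets are the nonvanishing loci of
polynomials; the regular functions are those that are locally quotients of polynomials. -/
def affine (σ : Type*) : SpaceWithFunctions (σ → ℂ) :=
  letI top : TopologicalSpace (σ → ℂ) := TopologicalSpace.generateFrom
    {U | ∃ P : MvPolynomial σ ℂ, U = {x | MvPolynomial.eval x P ≠ 0}}
  have hopen : ∀ (x : σ → ℂ) (P : MvPolynomial σ ℂ), MvPolynomial.eval x P ≠ 0 →
      ∀ᶠ y in @nhds _ top x, MvPolynomial.eval y P ≠ 0 := fun x P h =>
    (TopologicalSpace.isOpen_generateFrom_of_mem ⟨P, rfl⟩ : @IsOpen _ top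
      {y | MvPolynomial.eval y P ≠ 0}).mem_nhds h
  { top := top
    RegAt := fun x f => ∃ P Q : MvPolynomial σ ℂ, MvPolynomial.eval x Q ≠ 0 ∧
      ∀ᶠ y in @nhds _ top x, f y = MvPolynomial.eval y P / MvPolynomial.eval y Q
    congr' := by
      rintro x f g hfg ⟨P, Q, hQ, h⟩
      refine ⟨P, Q, hQ, ?_⟩
      filter_upwards [hfg, h] with y h1 h2
      rw [← h1, h2]
    eventually' := by
      rintro x f ⟨P, Q, hQ, h⟩
      filter_upwards [hopen x Q hQ, eventually_eventually_nhds.2 h] with y h1 h2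
      exact ⟨P, Q, h1, h2⟩
    const' := fun x c => ⟨MvPolynomial.C c, 1, by simp, by simp⟩
    add' := by
      rintro x f g ⟨P, Q, hQ, h⟩ ⟨P', Q', hQ', h'⟩
      refine ⟨P * Q' + Q * P', Q * Q', by simp [hQ, hQ'], ?_⟩
      filter_upwards [h, h', hopen x Q hQ, hopen x Q' hQ'] with y h1 h2 h3 h4
      simp only [Pi.add_apply, h1, h2, map_add, map_mul]
      rw [div_add_div _ _ h3 h4]
    mul' := by
      rintro x f g ⟨P, Q, hQ, h⟩ ⟨P', Q', hQ', h'⟩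
      refine ⟨P * P', Q * Q', by simp [hQ, hQ'], ?_⟩
      filter_upwards [h, h'] with y h1 h2
      simp only [Pi.mul_apply, h1, h2, map_mul]
      rw [div_mul_div_comm]
    inv' := by
      rintro x f ⟨P, Q, hQ, h⟩ hx
      have hP : MvPolynomial.eval x P ≠ 0 := by
        intro h0
        exact hx (by rw [h.self_of_nhds, h0, zero_div])
      refine ⟨?_, Q, P, hP, ?_⟩
      · filter_upwards [h, hopen x P hP, hopen x Q hQ] with y h1 h2 h3
        rw [h1]
        exact div_ne_zero h2 h3
      · filter_upwards [h] with y h1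
        rw [Pi.inv_apply, h1, inv_div] }

/-- The structure induced along a map `φ : X → Y`: open sets are preimages of open sets, and regular
functions are locally pullbacks of regular functions.  It is used for the inclusion of a (locally
closed) subset. -/
def induced (φ : X → Y) (S : SpaceWithFunctions Y) : SpaceWithFunctions X :=
  letI top : TopologicalSpace X := TopologicalSpace.induced φ S.top
  have hpull : ∀ (x : X) (p : Y → Prop), (∀ᶠ y in @nhds _ S.top (φ x), p y) →
      ∀ᶠ x' in @nhds _ top x, p (φ x') := fun x p h => by
    rw [@nhds_induced _ _ S.top φ x]
    exact h.comap φ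
  { top := top
    RegAt := fun x f => ∃ g, S.RegAt (φ x) g ∧ f =ᶠ[@nhds _ top x] g ∘ φ
    congr' := by
      rintro x f g hfg ⟨a, ha, h⟩
      exact ⟨a, ha, hfg.symm.trans h⟩
    eventually' := by
      rintro x f ⟨a, ha, h⟩
      filter_upwards [hpull x _ (S.eventually' _ _ ha), eventually_eventually_nhds.2 h] with y h1 h2
      exact ⟨a, h1, h2⟩
    const' := fun x c => ⟨fun _ => c, S.const' _ c, EventuallyEq.rfl⟩
    add' := by
      rintro x f g ⟨a, ha, h⟩ ⟨b, hb, h'⟩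
      exact ⟨a + b, S.add' _ _ _ ha hb, h.add h'⟩
    mul' := by
      rintro x f g ⟨a, ha, h⟩ ⟨b, hb, h'⟩
      exact ⟨a * b, S.mul' _ _ _ ha hb, h.mul h'⟩
    inv' := by
      rintro x f ⟨a, ha, h⟩ hx
      have hx' : f x = a (φ x) := h.self_of_nhds
      obtain ⟨h1, h2⟩ := S.inv' _ _ ha (hx' ▸ hx)
      refine ⟨?_, a⁻¹, h2, h.inv⟩
      filter_upwards [h, hpull x _ h1] with y h3 h4
      rw [h3]
      exact h4 }

/-- The quotient structure along `π : X → Y`: a set is open when its preimage is, and a function is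
regular on an open set when its pullback is. -/
def quotient (π : X → Y) (S : SpaceWithFunctions X) : SpaceWithFunctions Y :=
  letI top : TopologicalSpace Y := TopologicalSpace.coinduced π S.top
  have hpull : ∀ (x : X) (p : Y → Prop), (∀ᶠ y in @nhds _ top (π x), p y) →
      ∀ᶠ x' in @nhds _ S.top x, p (π x') := fun x p h =>
    letI := S.top
    (continuous_coinduced_rng (f := π)).continuousAt.eventually h
  { top := top
    RegAt := fun y f => ∀ᶠ y' in @nhds _ top y, ∀ x, π x = y' → S.RegAt x (f ∘ π)
    congr' := by
      intro y f g hfg h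
      filter_upwards [h, eventually_eventually_nhds.2 hfg] with z h1 h2 x hx
      subst hx
      exact S.congr' x _ _ (hpull x _ h2) (h1 x rfl)
    eventually' := fun y f h => eventually_eventually_nhds.2 h
    const' := fun y c => Eventually.of_forall fun _ x _ => S.const' x c
    add' := by
      intro y f g h h'
      filter_upwards [h, h'] with z h1 h2 x hx
      exact S.add' _ _ _ (h1 x hx) (h2 x hx)
    mul' := by
      intro y f g h h'
      filter_upwards [h, h'] with z h1 h2 x hx
      exact S.mul' _ _ _ (h1 x hx) (h2 x hx)
    inv' := by
      intro y f h hy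
      have key : ∀ᶠ y' in @nhds _ top y, f y' ≠ 0 := by
        obtain ⟨U, hU, hUo, hyU⟩ := eventually_nhds_iff.1 h
        refine eventually_nhds_iff.2 ⟨{z | z ∈ U ∧ f z ≠ 0}, fun z hz => hz.2, ?_, hyU, hy⟩
        change @IsOpen _ S.top (π ⁻¹' {z | z ∈ U ∧ f z ≠ 0})
        let := S.top
        rw [isOpen_iff_mem_nhds]
        rintro x ⟨hx1, hx2⟩
        have h1 := (S.inv' x _ (hU _ hx1 x rfl) hx2).1
        have h2 := hpull x _ (hUo.mem_nhds hx1)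
        filter_upwards [h1, h2] with x' h3 h4
        exact ⟨h4, h3⟩
      refine ⟨key, ?_⟩
      filter_upwards [h, key] with z h1 h2 x hx
      subst hx
      exact (S.inv' x _ (h1 x rfl) h2).2 }

/-- The algebra generated by functions `f` that are regular on `V i` for the structure `S i`. -/
def generatedFunctions {ι : Type*} (S : ι → SpaceWithFunctions X) (V : ι → Set X) :
    Subalgebra ℂ (X → ℂ) :=
  Algebra.adjoin ℂ {f | ∃ i, (S i).RegOn (V i) f}

theorem generatedFunctions_mono {ι : Type*} (S : ι → SpaceWithFunctions X) {V W : ι → Set X}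
    (h : ∀ i, W i ⊆ V i) : generatedFunctions S V ≤ generatedFunctions S W :=
  Algebra.adjoin_mono fun _ ⟨i, hi⟩ => ⟨i, fun x hx => hi x (h i hx)⟩

/-- The coarsest structure that refines finitely many structures `S i` on `X`: the basic open sets
are the nonvanishing loci, in `⋂ i, V i` with `V i` open for `S i`, of polynomials in functions
regular on the `V i`; regular functions are locally quotients of such polynomials. -/
def inf {ι : Type*} [Finite ι] (S : ι → SpaceWithFunctions X) : SpaceWithFunctions X :=
  letI top : TopologicalSpace X := TopologicalSpace.generateFrom
    {W | ∃ V : ι → Set X, (∀ i, (S i).Open (V i)) ∧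
      ∃ h ∈ generatedFunctions S V, W = {x | (∀ i, x ∈ V i) ∧ h x ≠ 0}}
  have hopen : ∀ (x : X) (V : ι → Set X), (∀ i, (S i).Open (V i)) → (∀ i, x ∈ V i) →
      ∀ h ∈ generatedFunctions S V, h x ≠ 0 →
      ∀ᶠ y in @nhds _ top x, (∀ i, y ∈ V i) ∧ h y ≠ 0 := fun x V hV hx h hh hne =>
    (TopologicalSpace.isOpen_generateFrom_of_mem ⟨V, hV, h, hh, rfl⟩ : @IsOpen _ top
      {y | (∀ i, y ∈ V i) ∧ h y ≠ 0}).mem_nhds ⟨hx, hne⟩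
  have hinter : ∀ V W : ι → Set X, (∀ i, (S i).Open (V i)) → (∀ i, (S i).Open (W i)) →
      ∀ i, (S i).Open (V i ∩ W i) := fun V W hV hW i =>
    @IsOpen.inter X (S i).top (V i) (W i) (hV i) (hW i)
  { top := top
    RegAt := fun x f => ∃ V : ι → Set X, (∀ i, (S i).Open (V i)) ∧ (∀ i, x ∈ V i) ∧
      ∃ g ∈ generatedFunctions S V, ∃ h ∈ generatedFunctions S V, h x ≠ 0 ∧
        f =ᶠ[@nhds _ top x] g / h
    congr' := by
      rintro x f f' hff ⟨V, hV, hx, g, hg, h, hh, hne, hf⟩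
      exact ⟨V, hV, hx, g, hg, h, hh, hne, hff.symm.trans hf⟩
    eventually' := by
      rintro x f ⟨V, hV, hx, g, hg, h, hh, hne, hf⟩
      filter_upwards [hopen x V hV hx h hh hne, eventually_eventually_nhds.2 hf] with y h1 h2
      exact ⟨V, hV, h1.1, g, hg, h, hh, h1.2, h2⟩
    const' := fun x c => ⟨fun _ => Set.univ, fun i => @isOpen_univ X (S i).top,
      fun _ => Set.mem_univ _, fun _ => c, (generatedFunctions S _).algebraMap_mem c, 1,
      one_mem _, one_ne_zero, by
        rw [div_one]⟩
    add' := by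
      rintro x f f' ⟨V, hV, hx, g, hg, h, hh, hne, hf⟩ ⟨V', hV', hx', g', hg', h', hh', hne', hf'⟩
      have m1 := generatedFunctions_mono S (V := V) (W := fun i => V i ∩ V' i)
        fun i => Set.inter_subset_left
      have m2 := generatedFunctions_mono S (V := V') (W := fun i => V i ∩ V' i)
        fun i => Set.inter_subset_right
      refine ⟨_, hinter V V' hV hV', fun i => ⟨hx i, hx' i⟩, g * h' + h * g',
        add_mem (mul_mem (m1 hg) (m2 hh')) (mul_mem (m1 hh) (m2 hg')), h * h',
        mul_mem (m1 hh) (m2 hh'), mul_ne_zero hne hne', ?_⟩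
      filter_upwards [hf, hf', hopen x V hV hx h hh hne, hopen x V' hV' hx' h' hh' hne']
        with y h1 h2 h3 h4
      simp only [Pi.add_apply, Pi.div_apply, Pi.mul_apply, h1, h2]
      rw [div_add_div _ _ h3.2 h4.2]
    mul' := by
      rintro x f f' ⟨V, hV, hx, g, hg, h, hh, hne, hf⟩ ⟨V', hV', hx', g', hg', h', hh', hne', hf'⟩
      have m1 := generatedFunctions_mono S (V := V) (W := fun i => V i ∩ V' i)
        fun i => Set.inter_subset_left
      have m2 := generatedFunctions_mono S (V := V') (W := fun i => V i ∩ V' i)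
        fun i => Set.inter_subset_right
      refine ⟨_, hinter V V' hV hV', fun i => ⟨hx i, hx' i⟩, g * g',
        mul_mem (m1 hg) (m2 hg'), h * h',
        mul_mem (m1 hh) (m2 hh'), mul_ne_zero hne hne', ?_⟩
      filter_upwards [hf, hf'] with y h1 h2
      simp only [Pi.div_apply, Pi.mul_apply, h1, h2]
      rw [div_mul_div_comm]
    inv' := by
      rintro x f ⟨V, hV, hx, g, hg, h, hh, hne, hf⟩ hfx
      have hgx : g x ≠ 0 := by
        intro h0
        exact hfx (by rw [hf.self_of_nhds, Pi.div_apply, h0, zero_div])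
      refine ⟨?_, V, hV, hx, h, hh, g, hg, hgx, ?_⟩
      · filter_upwards [hf, hopen x V hV hx g hg hgx, hopen x V hV hx h hh hne] with y h1 h2 h3
        rw [h1]
        exact div_ne_zero h2.2 h3.2
      · filter_upwards [hf] with y h1
        rw [Pi.inv_apply, h1, Pi.div_apply, Pi.div_apply, inv_div] }

/-- The product of finitely many spaces with functions. -/
def pi {ι : Type*} [Finite ι] {Z : ι → Type*} (S : ∀ i, SpaceWithFunctions (Z i)) :
    SpaceWithFunctions (∀ i, Z i) :=
  inf fun i => induced (fun p => p i) (S i)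

/-- The product of two spaces with functions. -/
def prod (S : SpaceWithFunctions X) (T : SpaceWithFunctions Y) : SpaceWithFunctions (X × Y) :=
  inf fun b : Bool => cond b (induced Prod.fst S) (induced Prod.snd T)

/-- Morphisms: continuous maps that pull regular functions back to regular functions. -/
def IsMorphism (S : SpaceWithFunctions X) (T : SpaceWithFunctions Y) (φ : X → Y) : Prop :=
  (∀ V, T.Open V → S.Open (φ ⁻¹' V)) ∧ ∀ x f, T.RegAt (φ x) f → S.RegAt x (f ∘ φ)

def IsIsomorphism (S : SpaceWithFunctions X) (T : SpaceWithFunctions Y) (e : X ≃ Y) : Prop :=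
  IsMorphism S T e ∧ IsMorphism T S e.symm

/-- An open embedding is an isomorphism onto an open subset. -/
def IsOpenEmbedding (S : SpaceWithFunctions X) (T : SpaceWithFunctions Y) (φ : X → Y) : Prop :=
  T.Open (Set.range φ) ∧ ∃ e : X ≃ Set.range φ, (∀ x, (e x : Y) = φ x) ∧
    IsIsomorphism S (induced Subtype.val T) e

/-- `ℂ^×`, as an open subset of the affine line. -/
def multiplicativeGroup : SpaceWithFunctions ℂˣ :=
  induced (fun (t : ℂˣ) (_ : Unit) => (t : ℂ)) (affine Unit)

/-- The torus `(ℂ^×)^ℓ`, as an open subset of affine `ℓ`-space. -/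
def torus (ℓ : ℕ) : SpaceWithFunctions (Fin ℓ → ℂˣ) :=
  induced (fun t i => (t i : ℂ)) (affine (Fin ℓ))

/-- `GL(k)`, as an open subset of the affine space of `k × k` matrices. -/
def generalLinear (k : ℕ) : SpaceWithFunctions (Matrix.GeneralLinearGroup (Fin k) ℂ) :=
  induced (fun M (p : Fin k × Fin k) => M.val p.1 p.2) (affine (Fin k × Fin k))

end SpaceWithFunctions

/-! ### Bruhat order on the symmetric group -/

/-- The length of a permutation: its number of inversions. -/
def permLength {k : ℕ} (w : Equiv.Perm (Fin k)) : ℕ :=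
  (Finset.univ.filter fun p : Fin k × Fin k => p.1 < p.2 ∧ w p.2 < w p.1).card

/-- Bruhat order: the reflexive transitive closure of `x → x t`, `t` a transposition with
`ℓ(x t) > ℓ(x)`. -/
def BruhatLE {k : ℕ} : Equiv.Perm (Fin k) → Equiv.Perm (Fin k) → Prop :=
  Relation.ReflTransGen fun x y =>
    (∃ a b : Fin k, a ≠ b ∧ y = x * Equiv.swap a b) ∧ permLength x < permLength y

def BruhatLT {k : ℕ} (x y : Equiv.Perm (Fin k)) : Prop := BruhatLE x y ∧ x ≠ y

/-- `v 0 < v 1 < ⋯ < v ℓ` is a maximal chain from `v 0` to `v ℓ`: it is strictly increasing and no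
permutation can be inserted between two consecutive terms. -/
def IsMaximalBruhatChain {k ℓ : ℕ} (v : Fin (ℓ + 1) → Equiv.Perm (Fin k)) : Prop :=
  ∀ i : Fin ℓ, BruhatLT (v i.castSucc) (v i.succ) ∧
    ∀ x, ¬ (BruhatLT (v i.castSucc) x ∧ BruhatLT x (v i.succ))

/-! ### Flags -/

/-- A complete flag `0 = F 0 ⊆ F 1 ⊆ ⋯ ⊆ F k = ℂ^k` with `dim F i = i`. -/
@[ext] structure CompleteFlag (k : ℕ) where
  subspace : Fin (k + 1) → Submodule ℂ (Fin k → ℂ)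
  mono : Monotone subspace
  finrank_eq : ∀ i, Module.finrank ℂ (subspace i) = i

namespace CompleteFlag

variable {k : ℕ}

/-- The flag whose `i`-th term is spanned by the first `i` vectors of `m`. -/
def ofVectors (m : Fin k → (Fin k → ℂ)) (hm : LinearIndependent ℂ m) : CompleteFlag k where
  subspace i := Submodule.span ℂ (m '' {j | (j : ℕ) < i})
  mono := fun i i' h => Submodule.span_mono (Set.image_mono fun j hj =>
    lt_of_lt_of_le hj (Fin.le_def.1 h))
  finrank_eq := fun i => by
    have h1 := finrank_span_eq_card (hm.comp (Fin.castLE (Nat.lt_succ_iff.1 i.2))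
      (Fin.castLE_injective _))
    rw [Fintype.card_fin] at h1
    have h2 : Set.range (m ∘ Fin.castLE (Nat.lt_succ_iff.1 i.2)) = m '' {j | (j : ℕ) < i} := by
      rw [Set.range_comp]
      congr 1
      ext j
      constructor
      · rintro ⟨a, rfl⟩
        exact a.2
      · intro hj
        exact ⟨⟨j, hj⟩, rfl⟩
    rw [← h2]
    exact h1

/-- The flag `𝓕(M)` spanned by the columns of an invertible matrix `M`. -/
def ofMatrix (M : Matrix.GeneralLinearGroup (Fin k) ℂ) : CompleteFlag k :=
  ofVectors (fun j => M.val.col j) (Matrix.linearIndependent_cols_of_isUnit M.isUnit)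

/-- The coordinate flag `𝓕(w)`, spanned by `e_{w(1)}, e_{w(2)}, …`. -/
def coordinate (w : Equiv.Perm (Fin k)) : CompleteFlag k :=
  ofVectors (fun j => Pi.single (w j) 1)
    ((Pi.linearIndependent_single_one (Fin k) ℂ).comp w w.injective)

/-- The action of `GL(k)` on flags. -/
def act (g : Matrix.GeneralLinearGroup (Fin k) ℂ) (F : CompleteFlag k) : CompleteFlag k where
  subspace i := (F.subspace i).map g.val.mulVecLin
  mono := fun _ _ h => Submodule.map_mono (F.mono h)
  finrank_eq := fun i => by
    rw [← F.finrank_eq i]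
    exact (Submodule.equivMapOfInjective g.val.mulVecLin
      (Matrix.mulVec_injective_of_isUnit g.isUnit) (F.subspace i)).finrank_eq.symm

/-- The longest permutation `i ↦ k + 1 - i`. -/
def longest (k : ℕ) : Equiv.Perm (Fin k) := Fin.revPerm

def standard (k : ℕ) : CompleteFlag k := coordinate 1

def antistandard (k : ℕ) : CompleteFlag k := coordinate (longest k)

/-- `F` and `F'` are in relative position `w`. -/
def RelPos (w : Equiv.Perm (Fin k)) (F F' : CompleteFlag k) : Prop :=
  ∃ g : Matrix.GeneralLinearGroup (Fin k) ℂ, act g F = standard k ∧ act g F' = coordinate w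

def Transverse (F F' : CompleteFlag k) : Prop := RelPos (longest k) F F'

/-- The flag variety, as the quotient of `GL(k)` by the upper triangular matrices, that is, by the
map `M ↦ 𝓕(M)`. -/
def variety (k : ℕ) : SpaceWithFunctions (CompleteFlag k) :=
  (SpaceWithFunctions.generalLinear k).quotient ofMatrix

end CompleteFlag

/-! ### Open Richardson varieties -/

open CompleteFlag in
/-- The open Richardson variety `R(u, w)`. -/
def Richardson {k : ℕ} (u w : Equiv.Perm (Fin k)) : Set (CompleteFlag k) :=
  {F | RelPos w (standard k) F ∧ RelPos (u⁻¹ * longest k) F (antistandard k)}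

namespace Richardson

variable {k : ℕ}

/-- The structure of `R(u, w)` as a locally closed subvariety of the flag variety. -/
def variety (u w : Equiv.Perm (Fin k)) : SpaceWithFunctions (Richardson u w) :=
  (CompleteFlag.variety k).induced Subtype.val

/-- The locus in `R(u, w)` of the flags transverse to `𝓕(v w₀)`. -/
def spliceLocus (u v w : Equiv.Perm (Fin k)) : Set (Richardson u w) :=
  {F | CompleteFlag.Transverse F.1 (CompleteFlag.coordinate (v * CompleteFlag.longest k))}

/-- The product `R(v₀, v₁) × R(v₁, v₂) × ⋯ × R(v_{ℓ-1}, v_ℓ)`. -/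
abbrev ChainProduct {ℓ : ℕ} (v : Fin (ℓ + 1) → Equiv.Perm (Fin k)) : Type :=
  ∀ i : Fin ℓ, Richardson (v i.castSucc) (v i.succ)

def chainVariety {ℓ : ℕ} (v : Fin (ℓ + 1) → Equiv.Perm (Fin k)) :
    SpaceWithFunctions (ChainProduct v) :=
  SpaceWithFunctions.pi (Z := fun i : Fin ℓ => Richardson (v i.castSucc) (v i.succ))
    fun i => variety (v i.castSucc) (v i.succ)

/-- A splicing map is an open embedding `R(u, v) × R(v, w) → R(u, w)` whose image is the locus of the
flags transverse to `𝓕(v w₀)`. -/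
def IsSplicing (u v w : Equiv.Perm (Fin k))
    (Ψ : Richardson u v × Richardson v w → Richardson u w) : Prop :=
  SpaceWithFunctions.IsOpenEmbedding ((variety u v).prod (variety v w)) (variety u w) Ψ ∧
    Set.range Ψ = spliceLocus u v w

/-- `ψ` is an iteration of splicing maps along the chain `v`: with splicing maps
`Ψ i : R(v₀, v_i) × R(v_i, v_{i+1}) → R(v₀, v_{i+1})`, the point `ψ p` is the last term of the
sequence `G j p ∈ R(v₀, v_j)` given by `G (i+1) p = Ψ i (G i p, p i)`, which starts at the only
point of `R(v₀, v₀)`. -/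
def IsIteratedSplicing {ℓ : ℕ} (v : Fin (ℓ + 1) → Equiv.Perm (Fin k))
    (ψ : ChainProduct v → Richardson (v 0) (v (Fin.last ℓ))) : Prop :=
  ∃ Ψ : ∀ i : Fin ℓ, Richardson (v 0) (v i.castSucc) × Richardson (v i.castSucc) (v i.succ) →
      Richardson (v 0) (v i.succ),
    (∀ i : Fin ℓ, IsSplicing (v 0) (v i.castSucc) (v i.succ) (Ψ i)) ∧
    ∃ G : ∀ j : Fin (ℓ + 1), ChainProduct v → Richardson (v 0) (v j),
      (∀ (i : Fin ℓ) (p : ChainProduct v), G i.succ p = Ψ i (G i.castSucc p, p i)) ∧ ψ = G (Fin.last ℓ)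

end Richardson

/-! Write B and B₋ for the upper and lower triangular groups, N₋ for the lower unitriangular one,
and view flags as cosets gB. Then R(u, w) is the intersection of the cells of BwB and B₋uB
(`Richardson.mem_iff`). The flags transverse to 𝓕(v w₀) form an open chart: with N_v = v N₋ v⁻¹,
each of them is x v B for a unique x in N_v, and x depends regularly on the flag
(`matrixRegAt_chart`).

Splicing happens inside this chart. Both R(u, v) and R(v, w) lie in it, with coordinates a in N_v ∩
B and b in N_v ∩ B₋. Factor a b⁻¹ = L U with L in N₋ and U in B, and put x = L⁻¹ a = U b. As x lies
in N₋ a, its flag stays in the cell of B₋uB; as x lies in B b, its flag stays in the cell of BwB.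
Conversely x determines a and b, by factoring x as lower times upper and as upper times lower. What
makes this work without shrinking the chart is that a matrix that is triangular for a permuted order
of the basis always has an LU decomposition (`hasLU_of_borel`), whose factors are triangular for the
same order (`lowerFactor_mem_borelSubgroup`). Everything is rational with nonvanishing denominators,
so the splicing map is an open embedding onto the required locus (`isSplicing_splicingMap`).
Composing along the chain, from the one-point variety R(v₀, v₀), gives ψ
(`exists_iteratedSplicing`).

For the factors, a Bruhat cover has the form w = u (a b) with no position between a and b whose
value lies between u a and u b (`exists_swap_of_bruhat_cover`). A dimension count (`truncate_mem`)
shows that the i-th term of a flag in R(u, w) splits along the first m coordinates whenever u and w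
have equally many values below m among their first i. This fails only for a < i ≤ b and u a < m ≤ u
b, and the remaining freedom is a single vector e_{u b} + t e_{u a} with t ≠ 0. The parameter t is
an entry of the chart around 𝓕(w), which makes t ↦ F an isomorphism from ℂ^×. -/

namespace SpaceWithFunctions

/-! ### Morphisms, universal properties and open embeddings of spaces with functions. -/

variable {X Y Z : Type*}

theorem eventually_comp {S : SpaceWithFunctions X} {T : SpaceWithFunctions Y} {φ : X → Y}
    (h : ∀ V, T.Open V → S.Open (φ ⁻¹' V)) {x : X} {p : Y → Prop}
    (hp : ∀ᶠ y in @nhds _ T.top (φ x), p y) : ∀ᶠ x' in @nhds _ S.top x, p (φ x') := by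
  let := S.top
  let := T.top
  exact (continuous_def.2 h : Continuous φ).continuousAt.eventually hp

theorem IsMorphism.id (S : SpaceWithFunctions X) : IsMorphism S S _root_.id :=
  ⟨fun _ h => h, fun _ _ h => h⟩

theorem IsMorphism.comp {S : SpaceWithFunctions X} {T : SpaceWithFunctions Y}
    {U : SpaceWithFunctions Z} {ψ : Y → Z} {φ : X → Y} (hψ : IsMorphism T U ψ)
    (hφ : IsMorphism S T φ) : IsMorphism S U (ψ ∘ φ) :=
  ⟨fun V hV => hφ.1 _ (hψ.1 V hV), fun x f hf => hφ.2 x _ (hψ.2 _ f hf)⟩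

theorem isMorphism_induced (φ : X → Y) (S : SpaceWithFunctions Y) :
    IsMorphism (induced φ S) S φ :=
  ⟨fun V hV => ⟨V, hV, rfl⟩, fun _ f hf => ⟨f, hf, EventuallyEq.rfl⟩⟩

/-- The universal property of a subspace; with `isMorphism_affine` and `IsMorphism.inf_lift` it
reduces each later morphism claim to the regularity of explicit functions. -/
theorem IsMorphism.induced_lift {S : SpaceWithFunctions Y} {T : SpaceWithFunctions Z} {φ : X → Y}
    {f : Z → X} (h : IsMorphism T S (φ ∘ f)) : IsMorphism T (induced φ S) f := by
  have h1 : ∀ V, (induced φ S).Open V → T.Open (f ⁻¹' V) := by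
    rintro _ ⟨W, hW, rfl⟩
    exact h.1 W hW
  refine ⟨h1, ?_⟩
  rintro z g ⟨a, ha, hg⟩
  exact T.congr' z _ _ ((eventually_comp h1 hg).mono fun _ h => h.symm) (h.2 z a ha)

theorem isMorphism_quotient (π : X → Y) (S : SpaceWithFunctions X) :
    IsMorphism S (quotient π S) π := by
  let := (quotient π S).top
  exact ⟨fun V hV => hV, fun x f hf => Eventually.self_of_nhds hf x rfl⟩

/-- The functions that are regular at a point form a subalgebra. -/
def regularAt (S : SpaceWithFunctions X) (x : X) : Subalgebra ℂ (X → ℂ) where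
  carrier := {f | S.RegAt x f}
  mul_mem' := S.mul' x _ _
  add_mem' := S.add' x _ _
  algebraMap_mem' := S.const' x

theorem mem_regularAt {S : SpaceWithFunctions X} {x : X} {f : X → ℂ} :
    f ∈ S.regularAt x ↔ S.RegAt x f := Iff.rfl

theorem RegAt.sum {S : SpaceWithFunctions X} {x : X} {ι : Type*} {s : Finset ι}
    {f : ι → X → ℂ} (h : ∀ i ∈ s, S.RegAt x (f i)) : S.RegAt x (fun y => ∑ i ∈ s, f i y) := by
  have := sum_mem (S := S.regularAt x) h
  rw [mem_regularAt] at this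
  convert this using 1
  ext y
  simp

theorem RegAt.prod {S : SpaceWithFunctions X} {x : X} {ι : Type*} {s : Finset ι}
    {f : ι → X → ℂ} (h : ∀ i ∈ s, S.RegAt x (f i)) : S.RegAt x (fun y => ∏ i ∈ s, f i y) := by
  have := prod_mem (S := S.regularAt x) h
  rw [mem_regularAt] at this
  convert this using 1
  ext y
  simp

theorem open_iff_eventually {S : SpaceWithFunctions X} {U : Set X} :
    S.Open U ↔ ∀ x ∈ U, ∀ᶠ y in @nhds _ S.top x, y ∈ U := by
  let := S.top
  exact isOpen_iff_mem_nhds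

theorem Open.inter {S : SpaceWithFunctions X} {U V : Set X} (hU : S.Open U) (hV : S.Open V) :
    S.Open (U ∩ V) := by
  let := S.top
  exact IsOpen.inter hU hV

theorem open_univ (S : SpaceWithFunctions X) : S.Open Set.univ := by
  let := S.top
  exact isOpen_univ

theorem RegAt.eval {σ : Type*} {S : SpaceWithFunctions X} {x : X} {f : X → σ → ℂ}
    (h : ∀ i, S.RegAt x (fun y => f y i)) (P : MvPolynomial σ ℂ) :
    S.RegAt x (fun y => MvPolynomial.eval (f y) P) := by
  induction P using MvPolynomial.induction_on with
  | C a => simpa using S.const' x a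
  | add p q hp hq => simpa only [map_add] using! S.add' x _ _ hp hq
  | mul_X p i hp =>
    simp only [map_mul, MvPolynomial.eval_X]
    exact S.mul' x _ _ hp (h i)

/-- A map into an affine space is a morphism as soon as its coordinates are regular. -/
theorem isMorphism_affine {σ : Type*} {S : SpaceWithFunctions X} {f : X → σ → ℂ}
    (h : ∀ x i, S.RegAt x (fun y => f y i)) : IsMorphism S (affine σ) f := by
  have h1 : ∀ V, (affine σ).Open V → S.Open (f ⁻¹' V) := by
    let := S.top
    let := (affine σ).top
    refine continuous_def.1 (continuous_generateFrom_iff.2 ?_)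
    rintro _ ⟨P, rfl⟩
    exact open_iff_eventually.2 fun x hx => (S.inv' x _ (RegAt.eval (h x) P) hx).1
  refine ⟨h1, ?_⟩
  rintro x g ⟨P, Q, hQ, hg⟩
  refine S.congr' x _ _ ((eventually_comp h1 hg).mono fun _ h => h.symm) ?_
  simp only [div_eq_mul_inv]
  exact S.mul' x _ _ (RegAt.eval (h x) P) (S.inv' x _ (RegAt.eval (h x) Q) hQ).2

theorem regAt_affine_apply {σ : Type*} (x : σ → ℂ) (i : σ) :
    (affine σ).RegAt x (fun y => y i) :=
  ⟨MvPolynomial.X i, 1, by simp, Eventually.of_forall fun y => by simp⟩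

theorem isMorphism_inf_apply {ι : Type*} [Finite ι] (S : ι → SpaceWithFunctions X) (i : ι) :
    IsMorphism (inf S) (S i) id := by
  classical
  have hV : ∀ V : Set X, (S i).Open V →
      ∀ j, (S j).Open (if j = i then V else Set.univ) := by
    intro V hV j
    split_ifs with hj
    · exact hj ▸ hV
    · exact (S j).open_univ
  constructor
  · intro V h
    -- `V` is placed in the `i`-th slot and the whole space in the others, with denominator 1.
    refine TopologicalSpace.isOpen_generateFrom_of_mem
      ⟨fun j => if j = i then V else Set.univ, hV V h, 1, one_mem _, ?_⟩
    ext x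
    simp only [Set.mem_preimage, id, Set.mem_ofPred_eq, Pi.one_apply, ne_eq, one_ne_zero,
      not_false_eq_true, and_true]
    refine ⟨fun hx j => ?_, fun hx => by simpa using hx i⟩
    split_ifs <;> simp [hx]
  · intro x f hf
    obtain ⟨V, hVf, hVo, hxV⟩ := (@eventually_nhds_iff _ (S i).top _ _).1 ((S i).eventually' x f hf)
    refine ⟨fun j => if j = i then V else Set.univ, hV V hVo, fun j => ?_, f,
      Algebra.subset_adjoin ⟨i, ?_⟩, 1, one_mem _, one_ne_zero, ?_⟩
    · dsimp only
      split_ifs <;> simp [hxV]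
    · intro y hy
      exact hVf y (by simpa using hy)
    · rw [div_one]
      rfl

/-- The generating functions pull back to regular functions, and these form an algebra closed under
inverting nonvanishing elements. Finiteness of `ι` makes the intersection of the preimages of the `V
i` open. -/
theorem IsMorphism.inf_lift {ι : Type*} [Finite ι] {S : ι → SpaceWithFunctions X}
    {T : SpaceWithFunctions Z} {f : Z → X} (h : ∀ i, IsMorphism T (S i) f) :
    IsMorphism T (inf S) f := by
  have hreg : ∀ (V : ι → Set X) (z : Z), (∀ i, f z ∈ V i) →
      ∀ g ∈ generatedFunctions S V, T.RegAt z (g ∘ f) := by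
    intro V z hz g hg
    induction hg using Algebra.adjoin_induction with
    | mem g hg =>
      obtain ⟨i, hi⟩ := hg
      exact (h i).2 z g (hi _ (hz i))
    | algebraMap r => exact T.const' z r
    | add a b _ _ ha hb => exact T.add' z _ _ ha hb
    | mul a b _ _ ha hb => exact T.mul' z _ _ ha hb
  have h1 : ∀ V, (inf S).Open V → T.Open (f ⁻¹' V) := by
    let := T.top
    let := (inf S).top
    refine continuous_def.1 (continuous_generateFrom_iff.2 ?_)
    rintro _ ⟨V, hV, g, hg, rfl⟩
    refine open_iff_eventually.2 fun z hz => ?_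
    have h2 : ∀ᶠ y in 𝓝 z, ∀ i, f y ∈ V i :=
      eventually_all.2 fun i => open_iff_eventually.1 ((h i).1 _ (hV i)) z (hz.1 i)
    filter_upwards [h2, (T.inv' z _ (hreg V z hz.1 g hg) hz.2).1] with y h3 h4
    exact ⟨h3, h4⟩
  refine ⟨h1, ?_⟩
  rintro z a ⟨V, hV, hz, g, hg, b, hb, hne, hab⟩
  refine T.congr' z _ _ ((eventually_comp h1 hab).mono fun _ h => h.symm) ?_
  have : T.RegAt z ((g ∘ f) * (b ∘ f)⁻¹) :=
    T.mul' z _ _ (hreg V z hz g hg) (T.inv' z _ (hreg V z hz b hb) hne).2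
  convert this using 1
  ext y
  simp [div_eq_mul_inv]

theorem isMorphism_pi_apply {ι : Type*} [Finite ι] {W : ι → Type*}
    (S : ∀ i, SpaceWithFunctions (W i)) (i : ι) : IsMorphism (pi S) (S i) (fun p => p i) :=
  (isMorphism_induced (fun p : ∀ i, W i => p i) (S i)).comp (isMorphism_inf_apply _ i)

theorem IsMorphism.pi_lift {ι : Type*} [Finite ι] {W : ι → Type*}
    {S : ∀ i, SpaceWithFunctions (W i)} {T : SpaceWithFunctions Z} {f : Z → ∀ i, W i}
    (h : ∀ i, IsMorphism T (S i) (fun z => f z i)) : IsMorphism T (pi S) f :=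
  IsMorphism.inf_lift fun i => IsMorphism.induced_lift (h i)

theorem isMorphism_fst (S : SpaceWithFunctions X) (T : SpaceWithFunctions Y) :
    IsMorphism (prod S T) S Prod.fst :=
  (isMorphism_induced Prod.fst S).comp
    (isMorphism_inf_apply (fun b : Bool => cond b (induced Prod.fst S) (induced Prod.snd T)) true)

theorem isMorphism_snd (S : SpaceWithFunctions X) (T : SpaceWithFunctions Y) :
    IsMorphism (prod S T) T Prod.snd :=
  (isMorphism_induced Prod.snd T).comp
    (isMorphism_inf_apply (fun b : Bool => cond b (induced Prod.fst S) (induced Prod.snd T)) false)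

theorem IsMorphism.prod_lift {S : SpaceWithFunctions X} {T : SpaceWithFunctions Y}
    {U : SpaceWithFunctions Z} {f : Z → X × Y} (h1 : IsMorphism U S (fun z => (f z).1))
    (h2 : IsMorphism U T (fun z => (f z).2)) : IsMorphism U (prod S T) f :=
  IsMorphism.inf_lift fun b => by
    cases b
    · exact IsMorphism.induced_lift h2
    · exact IsMorphism.induced_lift h1

/-- Every map between one-point spaces is a morphism. -/
theorem isMorphism_of_subsingleton [Subsingleton X] [Subsingleton Y]
    (S : SpaceWithFunctions X) (T : SpaceWithFunctions Y) (f : X → Y) : IsMorphism S T f := by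
  constructor
  · intro V _
    let := S.top
    rcases Set.eq_empty_or_nonempty (f ⁻¹' V) with h | h
    · rw [h]
      exact isOpen_empty
    · rw [Set.Nonempty.eq_univ h]
      exact isOpen_univ
  · intro x g _
    have : g ∘ f = fun _ => g (f x) := funext fun y => by rw [Subsingleton.elim y x]; rfl
    rw [this]
    exact S.const' x _

/-- A regular retraction defined on an open image already supplies the inverse isomorphism; this is
the form in which the splicing map is handled. -/
theorem IsOpenEmbedding.of_leftInverse {S : SpaceWithFunctions X} {T : SpaceWithFunctions Y}
    {φ : X → Y} (hφ : IsMorphism S T φ) (ho : T.Open (Set.range φ)) {σ : Set.range φ → X}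
    (hσ : IsMorphism (induced Subtype.val T) S σ)
    (hl : ∀ x, σ ⟨φ x, Set.mem_range_self x⟩ = x) : IsOpenEmbedding S T φ :=
  ⟨ho, ⟨fun x => ⟨φ x, Set.mem_range_self x⟩, σ, hl, by
    rintro ⟨_, x, rfl⟩
    simp only [hl]⟩, fun _ => rfl, IsMorphism.induced_lift hφ, hσ⟩

theorem IsOpenEmbedding.exists_leftInverse {S : SpaceWithFunctions X} {T : SpaceWithFunctions Y}
    {φ : X → Y} (h : IsOpenEmbedding S T φ) : IsMorphism S T φ ∧ ∃ σ : Set.range φ → X,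
      IsMorphism (induced Subtype.val T) S σ ∧ ∀ x, σ ⟨φ x, Set.mem_range_self x⟩ = x := by
  obtain ⟨_, e, he, h1, h2⟩ := h
  constructor
  · have : φ = Subtype.val ∘ e := funext fun x => (he x).symm
    rw [this]
    exact (isMorphism_induced _ _).comp h1
  · refine ⟨e.symm, h2, fun x => ?_⟩
    rw [Equiv.symm_apply_eq]
    exact Subtype.ext (he x).symm

theorem IsOpenEmbedding.comp {S : SpaceWithFunctions X} {T : SpaceWithFunctions Y}
    {U : SpaceWithFunctions Z} {ψ : Y → Z} {φ : X → Y} (hψ : IsOpenEmbedding T U ψ)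
    (hφ : IsOpenEmbedding S T φ) : IsOpenEmbedding S U (ψ ∘ φ) := by
  obtain ⟨mφ, σ, hσ, lσ⟩ := hφ.exists_leftInverse
  obtain ⟨mψ, τ, hτ, lτ⟩ := hψ.exists_leftInverse
  have hr : ∀ z : Set.range (ψ ∘ φ), z.1 ∈ Set.range ψ := by
    rintro ⟨_, x, rfl⟩
    exact ⟨φ x, rfl⟩
  have hr' : ∀ z : Set.range (ψ ∘ φ), τ ⟨z.1, hr z⟩ ∈ Set.range φ := by
    rintro ⟨_, x, rfl⟩
    exact ⟨x, (lτ (φ x)).symm⟩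
  refine IsOpenEmbedding.of_leftInverse (mψ.comp mφ) ?_
    (σ := fun z => σ ⟨τ ⟨z.1, hr z⟩, hr' z⟩) ?_ ?_
  -- `τ` pulls the open range of `φ` back to the trace on the range of `ψ` of an open set `W`, so
  -- the range of the composite is an intersection of two open sets.
  · obtain ⟨W, hW, hWe⟩ := hτ.1 _ hφ.1
    have : Set.range (ψ ∘ φ) = W ∩ Set.range ψ := by
      ext z
      constructor
      · rintro ⟨x, rfl⟩
        refine ⟨?_, φ x, rfl⟩
        have : (⟨ψ (φ x), Set.mem_range_self _⟩ : Set.range ψ) ∈ τ ⁻¹' Set.range φ := by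
          rw [Set.mem_preimage, lτ]
          exact ⟨x, rfl⟩
        rw [← hWe] at this
        exact this
      · rintro ⟨hz, y, rfl⟩
        have : (⟨ψ y, Set.mem_range_self _⟩ : Set.range ψ) ∈ τ ⁻¹' Set.range φ := by
          rw [← hWe]
          exact hz
        rw [Set.mem_preimage, lτ] at this
        obtain ⟨x, rfl⟩ := this
        exact ⟨x, rfl⟩
    rw [this]
    exact Open.inter hW hψ.1
  · refine hσ.comp (φ := fun z => ⟨τ ⟨z.1, hr z⟩, hr' z⟩) (IsMorphism.induced_lift ?_)
    exact hτ.comp (φ := fun z : Set.range (ψ ∘ φ) => (⟨z.1, hr z⟩ : Set.range ψ))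
      (IsMorphism.induced_lift (isMorphism_induced _ _))
  · intro x
    simp only [Function.comp_apply, lτ, lσ]

theorem IsOpenEmbedding.of_isIsomorphism {S : SpaceWithFunctions X} {T : SpaceWithFunctions Y}
    {e : X ≃ Y} (h : IsIsomorphism S T e) : IsOpenEmbedding S T e := by
  refine IsOpenEmbedding.of_leftInverse h.1 ?_ (σ := fun y => e.symm y.1)
    (h.2.comp (isMorphism_induced _ _)) fun x => e.symm_apply_apply x
  rw [e.surjective.range_eq]
  exact T.open_univ

theorem IsOpenEmbedding.prodMap {X' Y' : Type*} {S : SpaceWithFunctions X}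
    {T : SpaceWithFunctions Y} {S' : SpaceWithFunctions X'} {T' : SpaceWithFunctions Y'}
    {φ : X → Y} {ψ : X' → Y'} (hφ : IsOpenEmbedding S T φ) (hψ : IsOpenEmbedding S' T' ψ) :
    IsOpenEmbedding (prod S S') (prod T T') (Prod.map φ ψ) := by
  obtain ⟨mφ, σ, hσ, lσ⟩ := hφ.exists_leftInverse
  obtain ⟨mψ, τ, hτ, lτ⟩ := hψ.exists_leftInverse
  have hr : ∀ z : Set.range (Prod.map φ ψ), z.1.1 ∈ Set.range φ := by
    rintro ⟨_, x, rfl⟩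
    exact ⟨x.1, rfl⟩
  have hr' : ∀ z : Set.range (Prod.map φ ψ), z.1.2 ∈ Set.range ψ := by
    rintro ⟨_, x, rfl⟩
    exact ⟨x.2, rfl⟩
  refine IsOpenEmbedding.of_leftInverse
    (IsMorphism.prod_lift (mφ.comp (isMorphism_fst _ _)) (mψ.comp (isMorphism_snd _ _))) ?_
    (σ := fun z => (σ ⟨z.1.1, hr z⟩, τ ⟨z.1.2, hr' z⟩)) ?_ ?_
  · rw [Set.range_prodMap]
    exact Open.inter ((isMorphism_fst _ _).1 _ hφ.1) ((isMorphism_snd _ _).1 _ hψ.1)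
  · refine IsMorphism.prod_lift ?_ ?_
    · exact hσ.comp (φ := fun z : Set.range (Prod.map φ ψ) => (⟨z.1.1, hr z⟩ : Set.range φ))
        (IsMorphism.induced_lift ((isMorphism_fst _ _).comp (isMorphism_induced _ _)))
    · exact hτ.comp (φ := fun z : Set.range (Prod.map φ ψ) => (⟨z.1.2, hr' z⟩ : Set.range ψ))
        (IsMorphism.induced_lift ((isMorphism_snd _ _).comp (isMorphism_induced _ _)))
  · rintro ⟨x, y⟩
    simp only [Prod.map_apply, lσ, lτ]

end SpaceWithFunctions

/-! ### Borel subgroups for permuted orders of the basis. -/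

section Triangular

variable {k : ℕ}

theorem Matrix.BlockTriangular.mul_diag {R : Type*} [CommRing R] {M N : Matrix (Fin k) (Fin k) R}
    {σ : Equiv.Perm (Fin k)}
    (hM : M.BlockTriangular σ) (hN : N.BlockTriangular σ) (i : Fin k) :
    (M * N) i i = M i i * N i i := by
  rw [Matrix.mul_apply, Finset.sum_eq_single i]
  · intro j _ hj
    rcases lt_or_gt_of_ne (σ.injective.ne hj) with h | h
    · rw [hM h, zero_mul]
    · rw [hN h, mul_zero]
  · simp

theorem Matrix.BlockTriangular.inv_perm {M : Matrix (Fin k) (Fin k) ℂ} {σ : Equiv.Perm (Fin k)}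
    (hM : M.BlockTriangular σ) : (M⁻¹).BlockTriangular σ := by
  by_cases h : IsUnit M
  · have := h.invertible
    exact Matrix.blockTriangular_inv_of_blockTriangular hM
  · rw [Matrix.isUnit_iff_isUnit_det] at h
    rw [Matrix.nonsing_inv_apply_not_isUnit _ h]
    exact Matrix.blockTriangular_zero

/-- The Borel subgroup of matrices that are triangular for the order `σ` puts on the basis. -/
def borelSubgroup (σ : Equiv.Perm (Fin k)) : Subgroup (Matrix.GeneralLinearGroup (Fin k) ℂ) where
  carrier := {M | M.val.BlockTriangular σ}
  mul_mem' := fun ha hb => Matrix.BlockTriangular.mul ha hb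
  one_mem' := Matrix.blockTriangular_one
  inv_mem' := fun {M} hM => by
    change (M⁻¹).val.BlockTriangular σ
    rw [Matrix.coe_units_inv]
    exact Matrix.BlockTriangular.inv_perm hM

theorem mem_borelSubgroup {σ : Equiv.Perm (Fin k)} {M : Matrix.GeneralLinearGroup (Fin k) ℂ} :
    M ∈ borelSubgroup σ ↔ M.val.BlockTriangular σ := Iff.rfl

/-- The unipotentSubgroup radical of `borelSubgroup σ`. -/
def unipotentSubgroup (σ : Equiv.Perm (Fin k)) :
    Subgroup (Matrix.GeneralLinearGroup (Fin k) ℂ) where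
  carrier := {M | M ∈ borelSubgroup σ ∧ ∀ i, M.val i i = 1}
  mul_mem' := fun {a b} ha hb => ⟨mul_mem ha.1 hb.1, fun i => by
    rw [Units.val_mul, Matrix.BlockTriangular.mul_diag ha.1 hb.1, ha.2, hb.2, mul_one]⟩
  one_mem' := ⟨one_mem _, fun i => by simp⟩
  inv_mem' := fun {a} ha => ⟨inv_mem ha.1, fun i => by
    have h := Matrix.BlockTriangular.mul_diag ha.1 (inv_mem ha.1 : a⁻¹ ∈ borelSubgroup σ) i
    rw [← Units.val_mul, mul_inv_cancel, ha.2, one_mul] at h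
    simpa using h.symm⟩

theorem mem_unipotentSubgroup {σ : Equiv.Perm (Fin k)} {M : Matrix.GeneralLinearGroup (Fin k) ℂ} :
    M ∈ unipotentSubgroup σ ↔ M ∈ borelSubgroup σ ∧ ∀ i, M.val i i = 1 := Iff.rfl

/-- Left multiplication by the longest element reverses the order given by `σ`, so only the diagonal
survives. All uniqueness statements about LU factors and charts come from here. -/
theorem unipotent_inter_opposite {σ : Equiv.Perm (Fin k)}
    {M : Matrix.GeneralLinearGroup (Fin k) ℂ} (h : M ∈ unipotentSubgroup σ)
    (h' : M ∈ borelSubgroup (CompleteFlag.longest k * σ)) : M = 1 := by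
  ext i j
  rcases eq_or_ne i j with rfl | hij
  · simpa using h.2 i
  · simp only [Units.val_one, Matrix.one_apply_ne hij]
    rcases lt_or_gt_of_ne (σ.injective.ne hij) with h1 | h1
    · exact h' (by simpa [CompleteFlag.longest] using h1)
    · exact h.1 h1

theorem Matrix.BlockTriangular.det_perm {M : Matrix (Fin k) (Fin k) ℂ} {σ : Equiv.Perm (Fin k)}
    (hM : M.BlockTriangular σ) : M.det = ∏ i, M i i := by
  rw [← Matrix.det_submatrix_equiv_self σ.symm M, Matrix.det_of_isUpperTriangular]
  · exact Equiv.prod_comp σ.symm fun i => M i i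
  · intro i j h
    exact hM (by simpa using h)

theorem borel_diag_ne_zero {σ : Equiv.Perm (Fin k)} {M : Matrix.GeneralLinearGroup (Fin k) ℂ}
    (h : M ∈ borelSubgroup σ) (i : Fin k) : M.val i i ≠ 0 := by
  have h1 : M.val.det ≠ 0 := ((Matrix.isUnit_iff_isUnit_det _).1 M.isUnit).ne_zero
  rw [Matrix.BlockTriangular.det_perm h] at h1
  exact Finset.prod_ne_zero_iff.1 h1 i (Finset.mem_univ i)

/-! ### LU decomposition -/

/-- The matrix `A` with the columns after `c` replaced by those of the identity matrix; its
determinant is a leading principal minor of `A`. -/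
def truncateColumns (c : Fin k) (A : Matrix (Fin k) (Fin k) ℂ) : Matrix (Fin k) (Fin k) ℂ :=
  Matrix.of fun i j => if j ≤ c then A i j else (1 : Matrix (Fin k) (Fin k) ℂ) i j

/-- All leading principal minors of `A` are nonzero. -/
def HasLU (A : Matrix (Fin k) (Fin k) ℂ) : Prop := ∀ c, (truncateColumns c A).det ≠ 0

/-- The upper triangular matrix `V` for which `A * V` is lower unitriangular. -/
noncomputable def reducer (A : Matrix (Fin k) (Fin k) ℂ) : Matrix (Fin k) (Fin k) ℂ :=
  Matrix.of fun i c => if i ≤ c then (truncateColumns c A)⁻¹ i c else 0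

theorem truncateColumns_blockTriangular {σ : Equiv.Perm (Fin k)} {A : Matrix (Fin k) (Fin k) ℂ}
    (hA : A.BlockTriangular σ) (c : Fin k) : (truncateColumns c A).BlockTriangular σ := by
  intro i j h
  simp only [truncateColumns, Matrix.of_apply]
  split_ifs
  · exact hA h
  · exact Matrix.blockTriangular_one h

/-- Truncating columns, inverting and deleting entries all preserve triangularity for `σ`. Hence LU
decomposition does not leave a Borel subgroup. -/
theorem reducer_blockTriangular {σ : Equiv.Perm (Fin k)} {A : Matrix (Fin k) (Fin k) ℂ}
    (hA : A.BlockTriangular σ) : (reducer A).BlockTriangular σ := by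
  intro i j h
  simp only [reducer, Matrix.of_apply]
  split_ifs
  · exact (truncateColumns_blockTriangular hA j).inv_perm h
  · rfl

theorem reducer_upper (A : Matrix (Fin k) (Fin k) ℂ) :
    (reducer A).BlockTriangular (1 : Equiv.Perm (Fin k)) := by
  intro i j h
  simp only [reducer, Matrix.of_apply]
  exact if_neg (not_le.2 h)

theorem mul_reducer_apply {A : Matrix (Fin k) (Fin k) ℂ} (hA : HasLU A) {r c : Fin k}
    (h : r ≤ c) : (A * reducer A) r c = (1 : Matrix (Fin k) (Fin k) ℂ) r c := by
  rw [← Matrix.mul_nonsing_inv (truncateColumns c A) (isUnit_iff_ne_zero.2 (hA c)),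
    Matrix.mul_apply, Matrix.mul_apply]
  -- The terms with `s > c` are dropped by `reducer`; in the truncated matrix they meet an identity
  -- column, whose entry in row `r ≤ c < s` is zero.
  refine Finset.sum_congr rfl fun s _ => ?_
  simp only [reducer, truncateColumns, Matrix.of_apply]
  split_ifs with hs
  · rfl
  · rw [mul_zero, Matrix.one_apply_ne (ne_of_lt (lt_of_le_of_lt h (not_le.1 hs))), zero_mul]

/-- The leading principal minors of a matrix triangular for any order are products of its diagonal
entries. -/
theorem hasLU_of_borel {σ : Equiv.Perm (Fin k)} {M : Matrix.GeneralLinearGroup (Fin k) ℂ}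
    (h : M ∈ borelSubgroup σ) : HasLU M.val := by
  intro c
  rw [(truncateColumns_blockTriangular h c).det_perm, Finset.prod_ne_zero_iff]
  intro i _
  simp only [truncateColumns, Matrix.of_apply]
  split_ifs
  · exact borel_diag_ne_zero h i
  · simp

/-- Right multiplication by an upper triangular matrix mixes a column only with earlier ones, so
leading minors multiply. -/
theorem truncateColumns_mul {A U : Matrix (Fin k) (Fin k) ℂ}
    (hU : U.BlockTriangular (1 : Equiv.Perm (Fin k))) (c : Fin k) :
    truncateColumns c (A * U) = truncateColumns c A * truncateColumns c U := by
  ext i j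
  rw [Matrix.mul_apply]
  simp only [truncateColumns, Matrix.of_apply]
  split_ifs with hj
  · rw [Matrix.mul_apply]
    refine Finset.sum_congr rfl fun s _ => ?_
    split_ifs with hs
    · rfl
    · rw [hU (lt_of_le_of_lt hj (not_le.1 hs)), mul_zero, mul_zero]
  · rw [Finset.sum_eq_single j]
    · simp [hj]
    · intro s _ hs
      rw [Matrix.one_apply_ne hs, mul_zero]
    · simp

theorem HasLU.mul_upper {A : Matrix (Fin k) (Fin k) ℂ} (hA : HasLU A)
    {U : Matrix.GeneralLinearGroup (Fin k) ℂ} (hU : U ∈ borelSubgroup (1 : Equiv.Perm (Fin k))) :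
    HasLU (A * U.val) := by
  intro c
  rw [truncateColumns_mul hU, Matrix.det_mul]
  exact mul_ne_zero (hA c) (hasLU_of_borel hU c)

theorem exists_lower {A : Matrix (Fin k) (Fin k) ℂ} (hA : HasLU A) :
    ∃ L ∈ unipotentSubgroup (CompleteFlag.longest k), L.val = A * reducer A := by
  have h1 : (A * reducer A).BlockTriangular (CompleteFlag.longest k) := by
    intro i j h
    have hij : i < j := by simpa [CompleteFlag.longest] using h
    rw [mul_reducer_apply hA hij.le, Matrix.one_apply_ne hij.ne]
  have h2 : ∀ i, (A * reducer A) i i = 1 := fun i => by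
    rw [mul_reducer_apply hA le_rfl, Matrix.one_apply_eq]
  have h3 : (A * reducer A).det ≠ 0 := by
    rw [h1.det_perm]
    simp [h2]
  exact ⟨Matrix.GeneralLinearGroup.mkOfDetNeZero _ h3, ⟨h1, h2⟩, rfl⟩

open Classical in
/-- The lower unitriangular factor of a matrix. -/
noncomputable def lowerFactor (A : Matrix (Fin k) (Fin k) ℂ) :
    Matrix.GeneralLinearGroup (Fin k) ℂ :=
  if h : HasLU A then (exists_lower h).choose else 1

theorem lowerFactor_val {A : Matrix (Fin k) (Fin k) ℂ} (h : HasLU A) :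
    (lowerFactor A).val = A * reducer A := by
  rw [lowerFactor, dif_pos h]
  exact (exists_lower h).choose_spec.2

theorem lowerFactor_mem {A : Matrix (Fin k) (Fin k) ℂ} (h : HasLU A) :
    lowerFactor A ∈ unipotentSubgroup (CompleteFlag.longest k) := by
  rw [lowerFactor, dif_pos h]
  exact (exists_lower h).choose_spec.1

theorem inv_mul_lowerFactor_val {A : Matrix.GeneralLinearGroup (Fin k) ℂ} (h : HasLU A.val) :
    (A⁻¹ * lowerFactor A.val).val = reducer A.val := by
  rw [Units.val_mul, lowerFactor_val h, ← Matrix.mul_assoc, ← Units.val_mul, inv_mul_cancel,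
    Units.val_one, Matrix.one_mul]

theorem inv_mul_lowerFactor_mem {A : Matrix.GeneralLinearGroup (Fin k) ℂ} (h : HasLU A.val) :
    A⁻¹ * lowerFactor A.val ∈ borelSubgroup (1 : Equiv.Perm (Fin k)) := by
  rw [mem_borelSubgroup, inv_mul_lowerFactor_val h]
  exact reducer_upper _

theorem lowerFactor_mem_borelSubgroup {σ : Equiv.Perm (Fin k)}
    {A : Matrix.GeneralLinearGroup (Fin k) ℂ}
    (h : A ∈ borelSubgroup σ) : lowerFactor A.val ∈ borelSubgroup σ := by
  have hLU := hasLU_of_borel h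
  have h1 : A⁻¹ * lowerFactor A.val ∈ borelSubgroup σ := by
    rw [mem_borelSubgroup, inv_mul_lowerFactor_val hLU]
    exact reducer_blockTriangular h
  simpa using mul_mem h h1

theorem lowerFactor_mem_unipotentSubgroup {σ : Equiv.Perm (Fin k)}
    {A : Matrix.GeneralLinearGroup (Fin k) ℂ} (h : A ∈ borelSubgroup σ) :
    lowerFactor A.val ∈ unipotentSubgroup σ :=
  ⟨lowerFactor_mem_borelSubgroup h, (lowerFactor_mem (hasLU_of_borel h)).2⟩

/-- Uniqueness of the LU decomposition: two lower factors differ by a matrix that is both lower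
unitriangular and upper triangular. -/
theorem lowerFactor_mul_upper {L U : Matrix.GeneralLinearGroup (Fin k) ℂ}
    (hL : L ∈ unipotentSubgroup (CompleteFlag.longest k))
    (hU : U ∈ borelSubgroup (1 : Equiv.Perm (Fin k))) :
    lowerFactor (L * U).val = L := by
  have hLU : HasLU (L * U).val := (hasLU_of_borel hL.1).mul_upper hU
  have h1 : L⁻¹ * lowerFactor (L * U).val ∈ unipotentSubgroup (CompleteFlag.longest k) :=
    mul_mem (inv_mem hL) (lowerFactor_mem hLU)
  have h2 : L⁻¹ * lowerFactor (L * U).val ∈ borelSubgroup (1 : Equiv.Perm (Fin k)) := by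
    have := mul_mem hU (inv_mul_lowerFactor_mem hLU)
    rwa [mul_inv_rev, mul_assoc, mul_inv_cancel_left] at this
  have h3 : CompleteFlag.longest k * CompleteFlag.longest k = 1 := by
    ext i
    simp [CompleteFlag.longest]
  have := unipotent_inter_opposite h1 (by rwa [h3])
  rw [inv_mul_eq_one] at this
  exact this.symm

end Triangular

/-! ### Matrices of regular functions -/

namespace SpaceWithFunctions

variable {X : Type*} {k : ℕ}

/-- The entries of the matrix-valued function `A` are regular at `x`. -/
def MatrixRegAt (S : SpaceWithFunctions X) (x : X) (A : X → Matrix (Fin k) (Fin k) ℂ) : Prop :=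
  ∀ i j, S.RegAt x fun y => A y i j

variable {S : SpaceWithFunctions X} {x : X} {A B : X → Matrix (Fin k) (Fin k) ℂ}

theorem MatrixRegAt.const (M : Matrix (Fin k) (Fin k) ℂ) : S.MatrixRegAt x fun _ => M :=
  fun _ _ => S.const' x _

theorem MatrixRegAt.mul (hA : S.MatrixRegAt x A) (hB : S.MatrixRegAt x B) :
    S.MatrixRegAt x fun y => A y * B y := by
  intro i j
  simp only [Matrix.mul_apply]
  exact RegAt.sum fun s _ => S.mul' x _ _ (hA i s) (hB s j)

theorem MatrixRegAt.det (hA : S.MatrixRegAt x A) : S.RegAt x fun y => (A y).det := by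
  simp only [Matrix.det_apply']
  exact RegAt.sum fun σ _ => S.mul' x _ _ (S.const' x _) (RegAt.prod fun i _ => hA _ _)

/-- Cramer's rule: the entries of the adjugate are determinants with one row replaced by a constant
one. -/
theorem MatrixRegAt.inv (hA : S.MatrixRegAt x A) (h : (A x).det ≠ 0) :
    S.MatrixRegAt x fun y => (A y)⁻¹ := by
  intro i j
  simp only [Matrix.inv_def, Ring.inverse_eq_inv', Matrix.smul_apply, smul_eq_mul,
    Matrix.adjugate_apply]
  refine S.mul' x _ _ (S.inv' x _ hA.det h).2 (MatrixRegAt.det fun r s => ?_)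
  simp only [Matrix.updateRow_apply]
  split_ifs
  · exact S.const' x _
  · exact hA r s

theorem MatrixRegAt.truncateColumns (hA : S.MatrixRegAt x A) (c : Fin k) :
    S.MatrixRegAt x fun y => truncateColumns c (A y) := by
  intro i j
  simp only [_root_.truncateColumns, Matrix.of_apply]
  split_ifs
  · exact hA i j
  · exact S.const' x _

theorem MatrixRegAt.eventually_hasLU (hA : S.MatrixRegAt x A) (h : HasLU (A x)) :
    ∀ᶠ y in @nhds _ S.top x, HasLU (A y) :=
  eventually_all.2 fun c => (S.inv' x _ (hA.truncateColumns c).det (h c)).1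

theorem MatrixRegAt.reducer (hA : S.MatrixRegAt x A) (h : HasLU (A x)) :
    S.MatrixRegAt x fun y => reducer (A y) := by
  intro i j
  simp only [_root_.reducer, Matrix.of_apply]
  split_ifs
  · exact (hA.truncateColumns j).inv (h j) i j
  · exact S.const' x _

theorem MatrixRegAt.congr (hA : S.MatrixRegAt x A)
    (h : ∀ᶠ y in @nhds _ S.top x, A y = B y) : S.MatrixRegAt x B :=
  fun i j => S.congr' x _ _ (h.mono fun y hy => by rw [hy]) (hA i j)

theorem MatrixRegAt.lowerFactor (hA : S.MatrixRegAt x A) (h : HasLU (A x)) :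
    S.MatrixRegAt x fun y => (lowerFactor (A y)).val :=
  (hA.mul (hA.reducer h)).congr
    ((hA.eventually_hasLU h).mono fun _ hy => (lowerFactor_val hy).symm)

theorem MatrixRegAt.units_inv {A : X → Matrix.GeneralLinearGroup (Fin k) ℂ}
    (hA : S.MatrixRegAt x fun y => (A y).val) : S.MatrixRegAt x fun y => (A y)⁻¹.val := by
  simp only [Matrix.coe_units_inv]
  exact hA.inv ((Matrix.isUnit_iff_isUnit_det _).1 (A x).isUnit).ne_zero

theorem MatrixRegAt.units_mul {A B : X → Matrix.GeneralLinearGroup (Fin k) ℂ}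
    (hA : S.MatrixRegAt x fun y => (A y).val) (hB : S.MatrixRegAt x fun y => (B y).val) :
    S.MatrixRegAt x fun y => (A y * B y).val :=
  hA.mul hB

theorem matrixRegAt_generalLinear (M : Matrix.GeneralLinearGroup (Fin k) ℂ) :
    (generalLinear k).MatrixRegAt M fun N => N.val :=
  fun i j => ⟨fun p => p (i, j), regAt_affine_apply _ _, EventuallyEq.rfl⟩

theorem isMorphism_generalLinear {A : X → Matrix.GeneralLinearGroup (Fin k) ℂ}
    (hA : ∀ x, S.MatrixRegAt x fun y => (A y).val) : IsMorphism S (generalLinear k) A :=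
  IsMorphism.induced_lift (isMorphism_affine fun x p => hA x p.1 p.2)

theorem MatrixRegAt.comp {Y : Type*} {T : SpaceWithFunctions Y} {φ : Y → X}
    (hφ : IsMorphism T S φ) {y : Y} (hA : S.MatrixRegAt (φ y) A) :
    T.MatrixRegAt y fun z => A (φ z) :=
  fun i j => hφ.2 y _ (hA i j)

end SpaceWithFunctions

/-! ### Permutation matrices and conjugation of the Borel subgroups. -/

section PermMatrix

variable {k : ℕ}

/-- The permutation matrix whose `j`-th column is `e_{w(j)}`. -/
noncomputable def permGL (w : Equiv.Perm (Fin k)) : Matrix.GeneralLinearGroup (Fin k) ℂ where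
  val := (1 : Matrix (Fin k) (Fin k) ℂ).submatrix id w
  inv := (1 : Matrix (Fin k) (Fin k) ℂ).submatrix w id
  val_inv := by
    rw [Matrix.submatrix_mul_equiv _ _ id w id]
    simp
  inv_val := by
    ext i j
    rw [Matrix.mul_apply]
    simp [Matrix.one_apply]

theorem permGL_apply (w : Equiv.Perm (Fin k)) (i j : Fin k) :
    (permGL w).val i j = if i = w j then 1 else 0 := Matrix.one_apply

theorem mul_permGL_apply (M : Matrix.GeneralLinearGroup (Fin k) ℂ) (w : Equiv.Perm (Fin k))
    (i j : Fin k) : (M * permGL w).val i j = M.val i (w j) := by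
  simp [Matrix.mul_apply, permGL_apply]

theorem permGL_mul_apply (M : Matrix.GeneralLinearGroup (Fin k) ℂ) (w : Equiv.Perm (Fin k))
    (i j : Fin k) : (permGL w * M).val (w i) j = M.val i j := by
  simp [Matrix.mul_apply, permGL_apply]

theorem permGL_mul (u w : Equiv.Perm (Fin k)) : permGL (u * w) = permGL u * permGL w := by
  ext i j
  rw [mul_permGL_apply, permGL_apply, permGL_apply]
  rfl

theorem permGL_one : permGL (1 : Equiv.Perm (Fin k)) = 1 := by
  ext i j
  rw [permGL_apply, Units.val_one, Matrix.one_apply]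
  rfl

theorem permGL_inv (w : Equiv.Perm (Fin k)) : permGL w⁻¹ = (permGL w)⁻¹ := by
  rw [eq_inv_iff_mul_eq_one, ← permGL_mul, inv_mul_cancel, permGL_one]

theorem conj_permGL_apply (M : Matrix.GeneralLinearGroup (Fin k) ℂ) (w : Equiv.Perm (Fin k))
    (i j : Fin k) : (permGL w * M * (permGL w)⁻¹).val (w i) (w j) = M.val i j := by
  rw [← permGL_inv, mul_permGL_apply, permGL_mul_apply]
  simp

theorem conj_permGL_mem_borelSubgroup {M : Matrix.GeneralLinearGroup (Fin k) ℂ}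
    {v σ : Equiv.Perm (Fin k)} :
    permGL v * M * (permGL v)⁻¹ ∈ borelSubgroup σ ↔ M ∈ borelSubgroup (σ * v) := by
  constructor
  · intro h i j hij
    rw [← conj_permGL_apply M v]
    exact h hij
  · intro h i j hij
    obtain ⟨i, rfl⟩ := v.surjective i
    obtain ⟨j, rfl⟩ := v.surjective j
    rw [conj_permGL_apply]
    exact h hij

theorem conj_permGL_mem_unipotentSubgroup {M : Matrix.GeneralLinearGroup (Fin k) ℂ}
    {v σ : Equiv.Perm (Fin k)} :
    permGL v * M * (permGL v)⁻¹ ∈ unipotentSubgroup σ ↔ M ∈ unipotentSubgroup (σ * v) := by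
  rw [mem_unipotentSubgroup, mem_unipotentSubgroup, conj_permGL_mem_borelSubgroup,
    ← v.forall_congr_right]
  simp only [conj_permGL_apply]

end PermMatrix

/-! ### Flags as cosets of the upper triangular group, and relative positions. -/

namespace CompleteFlag

variable {k : ℕ}

theorem longest_mul_longest : longest k * longest k = 1 := by
  ext i
  simp [longest]

theorem longest_inv : (longest k)⁻¹ = longest k := by
  rw [inv_eq_iff_mul_eq_one, longest_mul_longest]

theorem act_ofMatrix (g M : Matrix.GeneralLinearGroup (Fin k) ℂ) :
    act g (ofMatrix M) = ofMatrix (g * M) := by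
  ext1
  funext i
  simp only [act, ofMatrix, ofVectors, Submodule.map_span, ← Set.image_comp]
  congr 2

theorem coordinate_eq (w : Equiv.Perm (Fin k)) : coordinate w = ofMatrix (permGL w) := by
  ext1
  funext i
  simp only [coordinate, ofMatrix, ofVectors]
  congr 2
  funext j
  ext r
  simp [permGL_apply, Pi.single_apply]

theorem standard_eq : standard k = ofMatrix 1 := by
  rw [standard, coordinate_eq, permGL_one]

theorem col_mem_ofMatrix (M : Matrix.GeneralLinearGroup (Fin k) ℂ) {i : Fin (k + 1)} {j : Fin k}
    (h : (j : ℕ) < i) : M.val.col j ∈ (ofMatrix M).subspace i :=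
  Submodule.subset_span ⟨j, h, rfl⟩

theorem apply_eq_zero_of_mem_standard {i : Fin (k + 1)} {x : Fin k → ℂ}
    (hx : x ∈ (ofMatrix (1 : Matrix.GeneralLinearGroup (Fin k) ℂ)).subspace i) {j : Fin k}
    (hj : (i : ℕ) ≤ j) : x j = 0 := by
  induction hx using Submodule.span_induction with
  | mem x hx =>
    obtain ⟨s, hs, rfl⟩ := hx
    have : j ≠ s := by
      rintro rfl
      exact absurd hs (not_lt.2 hj)
    simp [this]
  | zero => rfl
  | add x y _ _ hx hy => simp [hx, hy]
  | smul c x _ hx => simp [hx]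

theorem mem_standard {i : Fin (k + 1)} {x : Fin k → ℂ} (hx : ∀ j : Fin k, (i : ℕ) ≤ j → x j = 0) :
    x ∈ (ofMatrix (1 : Matrix.GeneralLinearGroup (Fin k) ℂ)).subspace i := by
  have : x = ∑ j, x j • (1 : Matrix.GeneralLinearGroup (Fin k) ℂ).val.col j := by
    ext r
    simp [Finset.sum_apply, Matrix.one_apply]
  rw [this]
  refine sum_mem fun j _ => ?_
  by_cases hj : (j : ℕ) < i
  · exact Submodule.smul_mem _ _ (col_mem_ofMatrix _ hj)
  · rw [hx j (not_lt.1 hj), zero_smul]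
    exact zero_mem _

/-- A flag contained in another one is equal to it. -/
theorem eq_of_le {F F' : CompleteFlag k} (h : ∀ i, F.subspace i ≤ F'.subspace i) : F = F' := by
  ext1
  funext i
  exact Submodule.eq_of_le_of_finrank_eq (h i) ((F.finrank_eq i).trans (F'.finrank_eq i).symm)

theorem ofMatrix_eq_of_cols {M : Matrix.GeneralLinearGroup (Fin k) ℂ} {F : CompleteFlag k}
    (h : ∀ j, M.val.col j ∈ F.subspace j.succ) : ofMatrix M = F := by
  refine eq_of_le fun i => Submodule.span_le.2 ?_
  rintro _ ⟨j, hj, rfl⟩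
  exact F.mono (Fin.le_def.2 (by simpa using hj)) (h j)

theorem ofMatrix_eq_one_iff {M : Matrix.GeneralLinearGroup (Fin k) ℂ} :
    ofMatrix M = ofMatrix 1 ↔ M ∈ borelSubgroup 1 := by
  constructor
  · intro h i j hij
    have := col_mem_ofMatrix M (i := j.succ) (j := j) (by simp)
    rw [h] at this
    exact apply_eq_zero_of_mem_standard this (j := i) (by simpa using hij)
  · intro h
    refine ofMatrix_eq_of_cols fun j => mem_standard fun i hi => ?_
    exact h (by simpa using hi)

theorem ofMatrix_eq_iff {M N : Matrix.GeneralLinearGroup (Fin k) ℂ} :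
    ofMatrix M = ofMatrix N ↔ N⁻¹ * M ∈ borelSubgroup 1 := by
  rw [← ofMatrix_eq_one_iff]
  constructor
  · intro h
    rw [← act_ofMatrix, h, act_ofMatrix, inv_mul_cancel]
  · intro h
    have := congrArg (act N) h
    rwa [act_ofMatrix, act_ofMatrix, mul_inv_cancel_left, mul_one] at this

theorem ofMatrix_mul_upper (M : Matrix.GeneralLinearGroup (Fin k) ℂ)
    {U : Matrix.GeneralLinearGroup (Fin k) ℂ} (hU : U ∈ borelSubgroup 1) :
    ofMatrix (M * U) = ofMatrix M :=
  ofMatrix_eq_iff.2 (by rwa [inv_mul_cancel_left])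

theorem act_inv_act (g : Matrix.GeneralLinearGroup (Fin k) ℂ) (F : CompleteFlag k) :
    act g⁻¹ (act g F) = F := by
  ext1
  funext i
  simp only [act, ← Submodule.map_comp]
  rw [← Matrix.mulVecLin_mul, ← Units.val_mul, inv_mul_cancel]
  simp

theorem relPos_standard_iff {w : Equiv.Perm (Fin k)} {F : CompleteFlag k} :
    RelPos w (standard k) F ↔
      ∃ x ∈ borelSubgroup (1 : Equiv.Perm (Fin k)), F = ofMatrix (x * permGL w) := by
  constructor
  · rintro ⟨g, h1, h2⟩
    rw [standard_eq, act_ofMatrix, mul_one, ofMatrix_eq_one_iff] at h1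
    refine ⟨g⁻¹, inv_mem h1, ?_⟩
    rw [← act_inv_act g F, h2, coordinate_eq, act_ofMatrix]
  · rintro ⟨x, hx, rfl⟩
    refine ⟨x⁻¹, ?_, ?_⟩
    · rw [standard_eq, act_ofMatrix, mul_one, ofMatrix_eq_one_iff]
      exact inv_mem hx
    · rw [act_ofMatrix, coordinate_eq, inv_mul_cancel_left]

/-- The stabilizer of 𝓕(b) is b B b⁻¹, the Borel subgroup for the order `b⁻¹`, and the flags in
position `a` to 𝓕(b) form its orbit of 𝓕(b a⁻¹). -/
theorem relPos_coordinate_iff {a b : Equiv.Perm (Fin k)} {F : CompleteFlag k} :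
    RelPos a F (coordinate b) ↔ ∃ x ∈ borelSubgroup b⁻¹, F = ofMatrix (x * permGL (b * a⁻¹)) := by
  -- Since 𝓕(a) is a b⁻¹ applied to 𝓕(b), the equation says that g a b⁻¹ stabilizes 𝓕(b).
  have conj : ∀ g : Matrix.GeneralLinearGroup (Fin k) ℂ, act g⁻¹ (coordinate b) = coordinate a ↔
      g * permGL (a * b⁻¹) ∈ borelSubgroup b⁻¹ := by
    intro g
    rw [coordinate_eq, coordinate_eq, act_ofMatrix, ofMatrix_eq_iff, ← inv_mem_iff,
      ← inv_mul_cancel b, ← conj_permGL_mem_borelSubgroup]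
    simp [mul_assoc, permGL_mul, permGL_inv]
  constructor
  · rintro ⟨g, h1, h2⟩
    refine ⟨g⁻¹ * permGL (a * b⁻¹), (conj _).1 (by rwa [inv_inv]), ?_⟩
    rw [mul_assoc, ← permGL_mul]
    simp only [mul_assoc, inv_mul_cancel_left, mul_inv_cancel, permGL_one, mul_one]
    rw [← act_inv_act g F, h1, standard_eq, act_ofMatrix, mul_one]
  · rintro ⟨x, hx, rfl⟩
    refine ⟨(x * permGL (b * a⁻¹))⁻¹, ?_, (conj _).2 ?_⟩
    · rw [act_ofMatrix, inv_mul_cancel, standard_eq]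
    · rw [mul_assoc, ← permGL_mul]
      simpa [mul_assoc, permGL_one] using hx

theorem transverse_iff {v : Equiv.Perm (Fin k)} {F : CompleteFlag k} :
    Transverse F (coordinate (v * longest k)) ↔
      ∃ x ∈ borelSubgroup (longest k * v⁻¹), F = ofMatrix (x * permGL v) := by
  rw [Transverse, relPos_coordinate_iff, mul_inv_rev, longest_inv, mul_assoc v,
    longest_mul_longest, mul_one]

/-! ### The chart around a coordinate flag -/

/-- The matrix with entries the coordinates of `𝓕(M)` in the chart around `𝓕(v)`. -/
noncomputable def chartMatrix (v : Equiv.Perm (Fin k)) (M : Matrix.GeneralLinearGroup (Fin k) ℂ) :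
    Matrix.GeneralLinearGroup (Fin k) ℂ :=
  permGL v * lowerFactor ((permGL v)⁻¹ * M).val * (permGL v)⁻¹

theorem chartMatrix_mem_unipotentSubgroup {v : Equiv.Perm (Fin k)}
    {M : Matrix.GeneralLinearGroup (Fin k) ℂ} (h : HasLU ((permGL v)⁻¹ * M).val) :
    chartMatrix v M ∈ unipotentSubgroup (longest k * v⁻¹) := by
  rw [chartMatrix, conj_permGL_mem_unipotentSubgroup, inv_mul_cancel_right]
  exact lowerFactor_mem h

theorem ofMatrix_chartMatrix {v : Equiv.Perm (Fin k)}
    {M : Matrix.GeneralLinearGroup (Fin k) ℂ} (h : HasLU ((permGL v)⁻¹ * M).val) :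
    ofMatrix (chartMatrix v M * permGL v) = ofMatrix M := by
  have := ofMatrix_mul_upper M (inv_mul_lowerFactor_mem h)
  rw [← this, chartMatrix]
  simp [mul_assoc]

/-- The orbit of 𝓕(v) under any Borel subgroup containing the torus lies in the chart around 𝓕(v),
with coordinates still in that subgroup. For `σ = 1` and `σ = longest k` this gives the charts on
R(u, v) and R(v, w). -/
theorem exists_unipotent_of_borel {v σ : Equiv.Perm (Fin k)}
    {x : Matrix.GeneralLinearGroup (Fin k) ℂ} (h : x ∈ borelSubgroup σ) :
    ∃ y ∈ unipotentSubgroup (longest k * v⁻¹), y ∈ borelSubgroup σ ∧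
      ofMatrix (y * permGL v) = ofMatrix (x * permGL v) := by
  have h1 : (permGL v)⁻¹ * (x * permGL v) ∈ borelSubgroup (σ * v) := by
    rw [← conj_permGL_mem_borelSubgroup]
    simpa [mul_assoc] using h
  have h2 := hasLU_of_borel h1
  refine ⟨_, chartMatrix_mem_unipotentSubgroup h2, ?_, ofMatrix_chartMatrix h2⟩
  rw [chartMatrix, conj_permGL_mem_borelSubgroup]
  exact lowerFactor_mem_borelSubgroup h1

theorem unipotent_eq_of_ofMatrix_eq {v : Equiv.Perm (Fin k)}
    {x y : Matrix.GeneralLinearGroup (Fin k) ℂ} (hx : x ∈ unipotentSubgroup (longest k * v⁻¹))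
    (hy : y ∈ unipotentSubgroup (longest k * v⁻¹))
    (h : ofMatrix (x * permGL v) = ofMatrix (y * permGL v)) : x = y := by
  rw [ofMatrix_eq_iff, ← inv_mul_cancel v, ← conj_permGL_mem_borelSubgroup] at h
  have h1 : y⁻¹ * x ∈ borelSubgroup (longest k * (longest k * v⁻¹)) := by
    rw [← mul_assoc, longest_mul_longest, one_mul]
    simpa [mul_assoc] using h
  exact (inv_mul_eq_one.1 (unipotent_inter_opposite (mul_mem (inv_mem hy) hx) h1)).symm

/-- The flags in the chart around `𝓕(v)`, that is, those transverse to `𝓕(v w₀)`. -/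
def chartDomain (v : Equiv.Perm (Fin k)) : Set (CompleteFlag k) :=
  {F | ∃ x ∈ unipotentSubgroup (longest k * v⁻¹), ofMatrix (x * permGL v) = F}

theorem transverse_iff_mem_chartDomain {v : Equiv.Perm (Fin k)} {F : CompleteFlag k} :
    Transverse F (coordinate (v * longest k)) ↔ F ∈ chartDomain v := by
  rw [transverse_iff]
  constructor
  · rintro ⟨x, hx, rfl⟩
    obtain ⟨y, hy, -, h⟩ := exists_unipotent_of_borel (v := v) hx
    exact ⟨y, hy, h⟩
  · rintro ⟨x, hx, rfl⟩
    exact ⟨x, hx.1, rfl⟩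

open Classical in
/-- The coordinates of a flag in the chart around `𝓕(v)`. -/
noncomputable def chart (v : Equiv.Perm (Fin k)) (F : CompleteFlag k) :
    Matrix.GeneralLinearGroup (Fin k) ℂ :=
  if h : F ∈ chartDomain v then h.choose else 1

theorem chart_mem {v : Equiv.Perm (Fin k)} {F : CompleteFlag k} (h : F ∈ chartDomain v) :
    chart v F ∈ unipotentSubgroup (longest k * v⁻¹) := by
  rw [chart, dif_pos h]
  exact h.choose_spec.1

theorem ofMatrix_chart {v : Equiv.Perm (Fin k)} {F : CompleteFlag k} (h : F ∈ chartDomain v) :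
    ofMatrix (chart v F * permGL v) = F := by
  rw [chart, dif_pos h]
  exact h.choose_spec.2

theorem chart_ofMatrix {v : Equiv.Perm (Fin k)} {x : Matrix.GeneralLinearGroup (Fin k) ℂ}
    (h : x ∈ unipotentSubgroup (longest k * v⁻¹)) : chart v (ofMatrix (x * permGL v)) = x :=
  have h1 : ofMatrix (x * permGL v) ∈ chartDomain v := ⟨x, h, rfl⟩
  unipotent_eq_of_ofMatrix_eq (chart_mem h1) h (ofMatrix_chart h1)

/-- Membership in the chart becomes the nonvanishing of minors of the representative, which makes
the chart open in the quotient topology. -/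
theorem ofMatrix_mem_chartDomain_iff {v : Equiv.Perm (Fin k)}
    {M : Matrix.GeneralLinearGroup (Fin k) ℂ} :
    ofMatrix M ∈ chartDomain v ↔ HasLU ((permGL v)⁻¹ * M).val := by
  constructor
  · rintro ⟨x, hx, h⟩
    rw [eq_comm, ofMatrix_eq_iff] at h
    have h1 : (permGL v)⁻¹ * (x * permGL v) ∈ borelSubgroup (longest k) := by
      rw [← inv_mul_cancel_right (longest k) v, ← conj_permGL_mem_borelSubgroup]
      simpa [mul_assoc] using hx.1
    have := (hasLU_of_borel h1).mul_upper h
    rw [← Units.val_mul] at this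
    simpa [mul_assoc] using this
  · intro h
    exact ⟨_, chartMatrix_mem_unipotentSubgroup h, ofMatrix_chartMatrix h⟩

theorem chart_ofMatrix_eq {v : Equiv.Perm (Fin k)} {M : Matrix.GeneralLinearGroup (Fin k) ℂ}
    (h : HasLU ((permGL v)⁻¹ * M).val) : chart v (ofMatrix M) = chartMatrix v M := by
  rw [← ofMatrix_chartMatrix h, chart_ofMatrix (chartMatrix_mem_unipotentSubgroup h)]

open SpaceWithFunctions

theorem isMorphism_ofMatrix : IsMorphism (generalLinear k) (variety k) ofMatrix :=
  isMorphism_quotient _ _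

theorem matrixRegAt_permGL_inv_mul (v : Equiv.Perm (Fin k))
    (M : Matrix.GeneralLinearGroup (Fin k) ℂ) :
    (generalLinear k).MatrixRegAt M fun N => ((permGL v)⁻¹ * N).val :=
  (MatrixRegAt.const (permGL v)⁻¹.val).mul (matrixRegAt_generalLinear M)

theorem isOpen_chartDomain (v : Equiv.Perm (Fin k)) : (variety k).Open (chartDomain v) := by
  change (generalLinear k).Open (ofMatrix ⁻¹' chartDomain v)
  refine open_iff_eventually.2 fun M hM => ?_
  simp only [Set.mem_preimage, ofMatrix_mem_chartDomain_iff] at hM ⊢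
  exact (matrixRegAt_permGL_inv_mul v M).eventually_hasLU hM

theorem matrixRegAt_chart {v : Equiv.Perm (Fin k)} {F : CompleteFlag k} (hF : F ∈ chartDomain v) :
    (variety k).MatrixRegAt F fun F' => (chart v F').val := by
  intro i j
  -- Regularity on the quotient is tested on all matrices representing nearby flags, where the chart
  -- is given by the explicit LU formula `chartMatrix`.
  refine (open_iff_eventually.1 (isOpen_chartDomain v) F hF).mono fun F' hF' M hM => ?_
  subst hM
  rw [ofMatrix_mem_chartDomain_iff] at hF'
  have h1 := matrixRegAt_permGL_inv_mul v M
  have h2 : (generalLinear k).MatrixRegAt M fun N => (chartMatrix v N).val :=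
    ((MatrixRegAt.const (permGL v).val).mul (h1.lowerFactor hF')).mul
      (MatrixRegAt.const (permGL v)⁻¹.val)
  exact h2.congr ((h1.eventually_hasLU hF').mono fun N hN => by rw [chart_ofMatrix_eq hN]) i j

end CompleteFlag

/-! ### Richardson varieties as intersections of opposite cells, inside the charts. -/

namespace Richardson

variable {k : ℕ}

open CompleteFlag SpaceWithFunctions

theorem mem_iff {u w : Equiv.Perm (Fin k)} {F : CompleteFlag k} :
    F ∈ Richardson u w ↔
      (∃ x ∈ borelSubgroup (1 : Equiv.Perm (Fin k)), F = ofMatrix (x * permGL w)) ∧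
      ∃ x ∈ borelSubgroup (longest k), F = ofMatrix (x * permGL u) := by
  refine and_congr relPos_standard_iff ?_
  rw [antistandard, relPos_coordinate_iff, longest_inv, mul_inv_rev, longest_inv, inv_inv,
    ← mul_assoc, longest_mul_longest, one_mul]

theorem mem_chartDomain_right {u v : Equiv.Perm (Fin k)} {F : CompleteFlag k}
    (h : F ∈ Richardson u v) : F ∈ chartDomain v := by
  obtain ⟨x, hx, rfl⟩ := (mem_iff.1 h).1
  obtain ⟨y, hy, -, e⟩ := exists_unipotent_of_borel (v := v) hx
  exact ⟨y, hy, e⟩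

theorem mem_chartDomain_left {v w : Equiv.Perm (Fin k)} {F : CompleteFlag k}
    (h : F ∈ Richardson v w) : F ∈ chartDomain v := by
  obtain ⟨x, hx, rfl⟩ := (mem_iff.1 h).2
  obtain ⟨y, hy, -, e⟩ := exists_unipotent_of_borel (v := v) hx
  exact ⟨y, hy, e⟩

theorem chart_mem_right {u v : Equiv.Perm (Fin k)} {F : CompleteFlag k}
    (h : F ∈ Richardson u v) : chart v F ∈ borelSubgroup (1 : Equiv.Perm (Fin k)) := by
  obtain ⟨x, hx, rfl⟩ := (mem_iff.1 h).1
  obtain ⟨y, hy, hy', e⟩ := exists_unipotent_of_borel (v := v) hx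
  rwa [← e, chart_ofMatrix hy]

theorem chart_mem_left {v w : Equiv.Perm (Fin k)} {F : CompleteFlag k}
    (h : F ∈ Richardson v w) : chart v F ∈ borelSubgroup (longest k) := by
  obtain ⟨x, hx, rfl⟩ := (mem_iff.1 h).2
  obtain ⟨y, hy, hy', e⟩ := exists_unipotent_of_borel (v := v) hx
  rwa [← e, chart_ofMatrix hy]

theorem isMorphism_val (u w : Equiv.Perm (Fin k)) :
    IsMorphism (variety u w) (CompleteFlag.variety k) Subtype.val :=
  isMorphism_induced _ _

theorem isMorphism_mk {X : Type*} {S : SpaceWithFunctions X} {u w : Equiv.Perm (Fin k)}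
    {M : X → Matrix.GeneralLinearGroup (Fin k) ℂ} (hM : ∀ x, S.MatrixRegAt x fun y => (M y).val)
    (h : ∀ x, ofMatrix (M x) ∈ Richardson u w) :
    IsMorphism S (variety u w) fun x => ⟨ofMatrix (M x), h x⟩ :=
  IsMorphism.induced_lift (isMorphism_ofMatrix.comp (isMorphism_generalLinear hM))

/-! ### The splicing map -/

section Factorization

variable {a b x : Matrix.GeneralLinearGroup (Fin k) ℂ}

/-- The point of the chart that splices the upper triangular `a` and the lower triangular `b`. -/
noncomputable def splice (a b : Matrix.GeneralLinearGroup (Fin k) ℂ) :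
    Matrix.GeneralLinearGroup (Fin k) ℂ :=
  (lowerFactor (a * b⁻¹).val)⁻¹ * a

/-- The upper triangular part of a point of the chart. -/
noncomputable def upperPart (x : Matrix.GeneralLinearGroup (Fin k) ℂ) :
    Matrix.GeneralLinearGroup (Fin k) ℂ :=
  (lowerFactor x.val)⁻¹ * x

/-- The lower triangular part of a point of the chart. -/
noncomputable def lowerPart (x : Matrix.GeneralLinearGroup (Fin k) ℂ) :
    Matrix.GeneralLinearGroup (Fin k) ℂ :=
  (lowerFactor (x⁻¹).val)⁻¹

variable {σ : Equiv.Perm (Fin k)}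

theorem splice_mem (ha : a ∈ unipotentSubgroup σ) (hb : b ∈ unipotentSubgroup σ) :
    splice a b ∈ unipotentSubgroup σ :=
  mul_mem (inv_mem (lowerFactor_mem_unipotentSubgroup (mul_mem ha (inv_mem hb)).1)) ha

theorem splice_mul_inv_mem_lower (ha : a ∈ borelSubgroup σ) (hb : b ∈ borelSubgroup σ) :
    splice a b * a⁻¹ ∈ unipotentSubgroup (longest k) := by
  rw [splice, mul_inv_cancel_right]
  exact inv_mem (lowerFactor_mem (hasLU_of_borel (mul_mem ha (inv_mem hb))))

/-- If a b⁻¹ = L U, then L⁻¹ a b⁻¹ = U: the spliced point also equals U b, the form adapted to the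
cell of `w`. -/
theorem splice_mul_inv_mem_upper (ha : a ∈ borelSubgroup σ) (hb : b ∈ borelSubgroup σ) :
    splice a b * b⁻¹ ∈ borelSubgroup 1 := by
  have := inv_mem (inv_mul_lowerFactor_mem (hasLU_of_borel (mul_mem ha (inv_mem hb))))
  rwa [mul_inv_rev, inv_inv, ← mul_assoc] at this

theorem upperPart_mem (hx : x ∈ unipotentSubgroup σ) : upperPart x ∈ unipotentSubgroup σ :=
  mul_mem (inv_mem (lowerFactor_mem_unipotentSubgroup hx.1)) hx

theorem upperPart_mem_upper (hx : x ∈ borelSubgroup σ) : upperPart x ∈ borelSubgroup 1 := by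
  have := inv_mem (inv_mul_lowerFactor_mem (hasLU_of_borel hx))
  rwa [mul_inv_rev, inv_inv] at this

theorem mul_upperPart_inv_mem (hx : x ∈ borelSubgroup σ) :
    x * (upperPart x)⁻¹ ∈ unipotentSubgroup (longest k) := by
  rw [upperPart, mul_inv_rev, inv_inv, mul_inv_cancel_left]
  exact lowerFactor_mem (hasLU_of_borel hx)

theorem lowerPart_mem (hx : x ∈ borelSubgroup σ) : lowerPart x ∈ unipotentSubgroup σ :=
  inv_mem (lowerFactor_mem_unipotentSubgroup (inv_mem hx))

theorem lowerPart_mem_lower (hx : x ∈ borelSubgroup σ) :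
    lowerPart x ∈ unipotentSubgroup (longest k) :=
  inv_mem (lowerFactor_mem (hasLU_of_borel (inv_mem hx)))

theorem mul_lowerPart_inv_mem (hx : x ∈ borelSubgroup σ) :
    x * (lowerPart x)⁻¹ ∈ borelSubgroup 1 := by
  have := inv_mul_lowerFactor_mem (hasLU_of_borel (inv_mem hx))
  rw [lowerPart, inv_inv]
  rwa [inv_inv] at this

/-- The spliced point is a lower unitriangular matrix times the upper triangular `a`, so uniqueness
of LU returns `a`. -/
theorem upperPart_splice (ha : a ∈ borelSubgroup σ) (hb : b ∈ borelSubgroup σ)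
    (ha' : a ∈ borelSubgroup 1) : upperPart (splice a b) = a := by
  have h := lowerFactor_mul_upper (splice_mul_inv_mem_lower ha hb) ha'
  rw [inv_mul_cancel_right] at h
  rw [upperPart, h]
  simp

/-- Inverting turns U b into b⁻¹ U⁻¹, lower times upper, so uniqueness of LU returns b⁻¹. -/
theorem lowerPart_splice (ha : a ∈ borelSubgroup σ) (hb : b ∈ borelSubgroup σ)
    (hb' : b ∈ unipotentSubgroup (longest k)) : lowerPart (splice a b) = b := by
  have h := lowerFactor_mul_upper (inv_mem hb') (inv_mem (splice_mul_inv_mem_upper ha hb))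
  rw [mul_inv_rev, inv_inv, inv_mul_cancel_left] at h
  rw [lowerPart, h, inv_inv]

theorem splice_upperPart_lowerPart (hx : x ∈ borelSubgroup σ) :
    splice (upperPart x) (lowerPart x) = x := by
  have h := lowerFactor_mul_upper (inv_mem (lowerFactor_mem (hasLU_of_borel hx)))
    (mul_lowerPart_inv_mem hx)
  rw [← mul_assoc] at h
  rw [splice, upperPart, h]
  simp

end Factorization

variable (u v w : Equiv.Perm (Fin k))

/-- The spliced flag is an upper triangular translate of `F'` and a lower triangular translate of
`F`; these translations preserve the cells of `w` and `u` respectively. -/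
theorem splice_mem_richardson {u v w : Equiv.Perm (Fin k)} {F F' : CompleteFlag k}
    (hF : F ∈ Richardson u v) (hF' : F' ∈ Richardson v w) :
    ofMatrix (splice (chart v F) (chart v F') * permGL v) ∈ Richardson u w := by
  have ha := (chart_mem (mem_chartDomain_right hF)).1
  have hb := (chart_mem (mem_chartDomain_left hF')).1
  rw [mem_iff]
  constructor
  · obtain ⟨x, hx, e⟩ := (mem_iff.1 hF').1
    refine ⟨_, mul_mem (splice_mul_inv_mem_upper ha hb) hx, ?_⟩
    rw [← ofMatrix_chart (mem_chartDomain_left hF')] at e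
    rw [mul_assoc _ x, ← act_ofMatrix _ (x * _), ← e, act_ofMatrix, ← mul_assoc,
      inv_mul_cancel_right]
  · obtain ⟨x, hx, e⟩ := (mem_iff.1 hF).2
    refine ⟨_, mul_mem (splice_mul_inv_mem_lower ha hb).1 hx, ?_⟩
    rw [← ofMatrix_chart (mem_chartDomain_right hF)] at e
    rw [mul_assoc _ x, ← act_ofMatrix _ (x * _), ← e, act_ofMatrix, ← mul_assoc,
      inv_mul_cancel_right]

theorem upperPart_mem_richardson {u v w : Equiv.Perm (Fin k)} {F : CompleteFlag k}
    (hF : F ∈ Richardson u w) (hv : F ∈ chartDomain v) :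
    ofMatrix (upperPart (chart v F) * permGL v) ∈ Richardson u v := by
  have hx := (chart_mem hv).1
  refine mem_iff.2 ⟨⟨_, upperPart_mem_upper hx, rfl⟩, ?_⟩
  obtain ⟨y, hy, e⟩ := (mem_iff.1 hF).2
  refine ⟨_, mul_mem (inv_mem (mul_upperPart_inv_mem hx).1) hy, ?_⟩
  rw [mul_assoc _ y, ← act_ofMatrix _ (y * _), ← (ofMatrix_chart hv).trans e, act_ofMatrix]
  simp [mul_assoc]

theorem lowerPart_mem_richardson {u v w : Equiv.Perm (Fin k)} {F : CompleteFlag k}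
    (hF : F ∈ Richardson u w) (hv : F ∈ chartDomain v) :
    ofMatrix (lowerPart (chart v F) * permGL v) ∈ Richardson v w := by
  have hx := (chart_mem hv).1
  refine mem_iff.2 ⟨?_, ⟨_, (lowerPart_mem_lower hx).1, rfl⟩⟩
  obtain ⟨y, hy, e⟩ := (mem_iff.1 hF).1
  refine ⟨_, mul_mem (inv_mem (mul_lowerPart_inv_mem hx)) hy, ?_⟩
  rw [mul_assoc _ y, ← act_ofMatrix _ (y * _), ← (ofMatrix_chart hv).trans e, act_ofMatrix]
  simp [mul_assoc]

theorem lower_unipotent_of_mem {v w : Equiv.Perm (Fin k)} {F : CompleteFlag k}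
    (h : F ∈ Richardson v w) : chart v F ∈ unipotentSubgroup (longest k) :=
  ⟨chart_mem_left h, (chart_mem (mem_chartDomain_left h)).2⟩

/-- The splicing map `R(u, v) × R(v, w) → R(u, w)`. -/
noncomputable def splicingMap (p : Richardson u v × Richardson v w) : Richardson u w :=
  ⟨ofMatrix (splice (chart v p.1.1) (chart v p.2.1) * permGL v),
    splice_mem_richardson p.1.2 p.2.2⟩

theorem chart_splicingMap (p : Richardson u v × Richardson v w) :
    chart v (splicingMap u v w p).1 = splice (chart v p.1.1) (chart v p.2.1) :=
  chart_ofMatrix (splice_mem (chart_mem (mem_chartDomain_right p.1.2))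
    (chart_mem (mem_chartDomain_left p.2.2)))

theorem splicingMap_mem_chartDomain (p : Richardson u v × Richardson v w) :
    (splicingMap u v w p).1 ∈ chartDomain v :=
  ⟨_, splice_mem (chart_mem (mem_chartDomain_right p.1.2))
    (chart_mem (mem_chartDomain_left p.2.2)), rfl⟩

theorem range_splicingMap : Set.range (splicingMap u v w) = {F | F.1 ∈ chartDomain v} := by
  ext F
  constructor
  · rintro ⟨p, rfl⟩
    exact splicingMap_mem_chartDomain u v w p
  · intro hF
    have hx := chart_mem hF
    refine ⟨(⟨_, upperPart_mem_richardson F.2 hF⟩, ⟨_, lowerPart_mem_richardson F.2 hF⟩), ?_⟩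
    apply Subtype.ext
    simp only [splicingMap]
    rw [chart_ofMatrix (upperPart_mem hx), chart_ofMatrix (lowerPart_mem hx.1),
      splice_upperPart_lowerPart hx.1, ofMatrix_chart hF]

theorem isSplicing_splicingMap : IsSplicing u v w (splicingMap u v w) := by
  have hr := range_splicingMap u v w
  have hd : ∀ F : Set.range (splicingMap u v w), F.1.1 ∈ chartDomain v :=
    fun F => hr.subset F.2
  refine ⟨?_, ?_⟩
  · refine IsOpenEmbedding.of_leftInverse ?_ ?_
      (σ := fun F => (⟨_, upperPart_mem_richardson F.1.2 (hd F)⟩,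
        ⟨_, lowerPart_mem_richardson F.1.2 (hd F)⟩)) ?_ ?_
    · refine isMorphism_mk (M := fun p : Richardson u v × Richardson v w =>
        splice (chart v p.1.1) (chart v p.2.1) * permGL v) (fun p => ?_) _
      have ha : ((variety u v).prod (variety v w)).MatrixRegAt p fun p => (chart v p.1.1).val :=
        MatrixRegAt.comp ((isMorphism_val u v).comp (isMorphism_fst _ _))
          (matrixRegAt_chart (mem_chartDomain_right p.1.2))
      have hb : ((variety u v).prod (variety v w)).MatrixRegAt p fun p => (chart v p.2.1).val :=
        MatrixRegAt.comp ((isMorphism_val v w).comp (isMorphism_snd _ _))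
          (matrixRegAt_chart (mem_chartDomain_left p.2.2))
      have hc := (ha.units_mul hb.units_inv).lowerFactor (hasLU_of_borel
        (mul_mem (chart_mem (mem_chartDomain_right p.1.2)).1
          (inv_mem (chart_mem (mem_chartDomain_left p.2.2)).1)))
      exact (hc.units_inv.units_mul ha).units_mul (B := fun _ => permGL v) (MatrixRegAt.const _)
    · rw [hr]
      exact (isMorphism_val u w).1 _ (isOpen_chartDomain v)
    · have hx : ∀ F : Set.range (splicingMap u v w),
          ((variety u w).induced Subtype.val).MatrixRegAt F fun F => (chart v F.1.1).val :=
        fun F => MatrixRegAt.comp ((isMorphism_val u w).comp (isMorphism_induced _ _))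
          (matrixRegAt_chart (hd F))
      have hB := fun F : Set.range (splicingMap u v w) => (chart_mem (hd F)).1
      refine IsMorphism.prod_lift ?_ ?_
      · refine isMorphism_mk (M := fun F : Set.range (splicingMap u v w) =>
          upperPart (chart v F.1.1) * permGL v) (fun F => ?_) _
        exact (((hx F).lowerFactor (hasLU_of_borel (hB F))).units_inv.units_mul (hx F)).units_mul
          (B := fun _ => permGL v) (MatrixRegAt.const _)
      · refine isMorphism_mk (M := fun F : Set.range (splicingMap u v w) =>
          lowerPart (chart v F.1.1) * permGL v) (fun F => ?_) _
        exact ((hx F).units_inv.lowerFactor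
          (hasLU_of_borel (inv_mem (hB F)))).units_inv.units_mul
          (B := fun _ => permGL v) (MatrixRegAt.const _)
    · rintro p
      have ha := (chart_mem (mem_chartDomain_right p.1.2)).1
      have hb := (chart_mem (mem_chartDomain_left p.2.2)).1
      ext1
      · apply Subtype.ext
        simp only [chart_splicingMap]
        rw [upperPart_splice ha hb (chart_mem_right p.1.2),
          ofMatrix_chart (mem_chartDomain_right p.1.2)]
      · apply Subtype.ext
        simp only [chart_splicingMap]
        rw [lowerPart_splice ha hb (lower_unipotent_of_mem p.2.2),
          ofMatrix_chart (mem_chartDomain_left p.2.2)]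
  · rw [hr]
    ext F
    exact transverse_iff_mem_chartDomain.symm

/-! ### Iterated splicing -/

theorem coordinate_mem : coordinate v ∈ Richardson v v :=
  mem_iff.2 ⟨⟨1, one_mem _, by rw [coordinate_eq, one_mul]⟩,
    ⟨1, one_mem _, by rw [coordinate_eq, one_mul]⟩⟩

/-- The chart coordinate is both lower unitriangular and upper triangular, hence 1. -/
instance : Subsingleton (Richardson v v) where
  allEq F F' := by
    have h : ∀ F : Richardson v v, F.1 = ofMatrix (1 * permGL v) := fun F => by
      rw [← ofMatrix_chart (mem_chartDomain_left F.2),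
        unipotent_inter_opposite (lower_unipotent_of_mem F.2)
          (by rw [longest_mul_longest]; exact chart_mem_right F.2)]
    exact Subtype.ext ((h F).trans (h F').symm)

theorem exists_iteratedSplicing {ℓ : ℕ} (v : Fin (ℓ + 1) → Equiv.Perm (Fin k)) :
    ∀ Ψ : ∀ i : Fin ℓ, Richardson (v 0) (v i.castSucc) × Richardson (v i.castSucc) (v i.succ) →
      Richardson (v 0) (v i.succ),
    (∀ i : Fin ℓ, IsSplicing (v 0) (v i.castSucc) (v i.succ) (Ψ i)) →
    ∃ G : ∀ j : Fin (ℓ + 1), ChainProduct v → Richardson (v 0) (v j),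
      (∀ (i : Fin ℓ) (p : ChainProduct v), G i.succ p = Ψ i (G i.castSucc p, p i)) ∧
      IsOpenEmbedding (chainVariety v) (variety (v 0) (v (Fin.last ℓ))) (G (Fin.last ℓ)) := by
  induction ℓ with
  | zero =>
    intro Ψ _
    have hs : ∀ j : Fin 1, Subsingleton (Richardson (v 0) (v j)) := fun j => by
      rw [Subsingleton.elim j 0]
      infer_instance
    have := hs (Fin.last 0)
    have hsp : Subsingleton (ChainProduct v) := ⟨fun p q => funext fun i => i.elim0⟩
    have hm : ∀ j : Fin 1, coordinate (v 0) ∈ Richardson (v 0) (v j) := fun j => by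
      rw [Subsingleton.elim j 0]
      exact coordinate_mem _
    refine ⟨fun j _ => ⟨coordinate (v 0), hm j⟩, fun i => i.elim0, ?_⟩
    refine IsOpenEmbedding.of_leftInverse (isMorphism_of_subsingleton _ _ _) ?_
      (σ := fun _ i => i.elim0) (isMorphism_of_subsingleton _ _ _) fun _ => Subsingleton.elim _ _
    have : Nonempty (ChainProduct v) := ⟨fun i => i.elim0⟩
    rw [(Set.range_nonempty _).eq_univ]
    exact open_univ _
  | succ ℓ ih =>
    intro Ψ hΨ
    obtain ⟨G, hG, hGo⟩ := ih (fun i => v i.castSucc) (fun i => Ψ i.castSucc) fun i => hΨ i.castSucc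
    let r : ChainProduct v → ChainProduct (fun i => v i.castSucc) := fun p i => p i.castSucc
    -- The earlier terms of the sequence ignore the last factor; only the last term splices it in.
    let G' : ∀ j : Fin (ℓ + 2), ChainProduct v → Richardson (v 0) (v j) :=
      Fin.lastCases (fun p => Ψ (Fin.last ℓ) (G (Fin.last ℓ) (r p), p (Fin.last ℓ)))
        fun j p => G j (r p)
    have hl : G' (Fin.last (ℓ + 1)) =
        fun p => Ψ (Fin.last ℓ) (G (Fin.last ℓ) (r p), p (Fin.last ℓ)) :=
      Fin.lastCases_last
    have hc : ∀ j : Fin (ℓ + 1), G' j.castSucc = fun p => G j (r p) := fun j =>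
      Fin.lastCases_castSucc j
    refine ⟨G', ?_, ?_⟩
    · intro i p
      induction i using Fin.lastCases with
      | last =>
        rw [hc]
        exact congrFun hl p
      | cast i =>
        rw [hc]
        exact (congrFun (hc i.succ) p).trans (hG i (r p))
    · let e : ChainProduct v ≃ ChainProduct (fun i => v i.castSucc) ×
          Richardson (v (Fin.last ℓ).castSucc) (v (Fin.last ℓ).succ) :=
        { toFun := fun p => (r p, p (Fin.last ℓ))
          invFun := fun q => Fin.lastCases q.2 q.1
          left_inv := fun p => by
            funext i
            induction i using Fin.lastCases with
            | last => simp
            | cast i => simp [r]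
          right_inv := fun q => by
            ext1
            · funext i
              simp [r]
            · simp }
      have he : IsIsomorphism (chainVariety v)
          ((chainVariety fun i => v i.castSucc).prod (variety _ _)) e := by
        refine ⟨IsMorphism.prod_lift (IsMorphism.pi_lift fun i => ?_) ?_,
          IsMorphism.pi_lift fun i => ?_⟩
        · exact isMorphism_pi_apply
            (W := fun i : Fin (ℓ + 1) => Richardson (v i.castSucc) (v i.succ))
            (fun i => variety (v i.castSucc) (v i.succ)) i.castSucc
        · exact isMorphism_pi_apply
            (W := fun i : Fin (ℓ + 1) => Richardson (v i.castSucc) (v i.succ))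
            (fun i => variety (v i.castSucc) (v i.succ)) (Fin.last ℓ)
        · induction i using Fin.lastCases with
          | last =>
            have : (fun q => e.symm q (Fin.last ℓ)) = Prod.snd := by
              funext q
              simp [e]
            rw [this]
            exact isMorphism_snd _ _
          | cast i =>
            have : (fun q => e.symm q i.castSucc) = fun q => q.1 i := by
              funext q
              simp [e]
            rw [this]
            exact (isMorphism_pi_apply
              (W := fun i : Fin ℓ => Richardson (v i.castSucc.castSucc) (v i.succ.castSucc))
              (fun i => variety (v i.castSucc.castSucc) (v i.succ.castSucc)) i).comp
              (isMorphism_fst _ _)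
      have hid : IsOpenEmbedding (variety (v (Fin.last ℓ).castSucc) (v (Fin.last ℓ).succ))
          (variety (v (Fin.last ℓ).castSucc) (v (Fin.last ℓ).succ)) id :=
        IsOpenEmbedding.of_isIsomorphism (e := Equiv.refl _) ⟨IsMorphism.id _, IsMorphism.id _⟩
      rw [hl]
      exact (hΨ (Fin.last ℓ)).1.comp ((hGo.prodMap hid).comp (IsOpenEmbedding.of_isIsomorphism he))

end Richardson

/-! ### Covers in the Bruhat order. -/

section BruhatCover

variable {k : ℕ}

theorem permLength_lt_mul_swap (x : Equiv.Perm (Fin k)) {a b : Fin k} (hab : a < b)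
    (h : x a < x b) : permLength x < permLength (x * Equiv.swap a b) := by
  set t := Equiv.swap a b with ht
  have hmem : (a, b) ∈ Finset.univ.filter fun p : Fin k × Fin k =>
      p.1 < p.2 ∧ (x * t) p.2 < (x * t) p.1 := by
    simp [ht, hab, h]
  rw [permLength, permLength, ← Finset.card_erase_add_one hmem, Nat.lt_succ_iff]
  -- An inversion of `x` is moved by the transposition when this keeps its positions in order, and
  -- is left alone otherwise. The image avoids the new inversion `(a, b)`.
  refine Finset.card_le_card_of_injOn
    (fun p => if t p.1 < t p.2 then (t p.1, t p.2) else p) ?_ ?_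
  · rintro ⟨i, j⟩ hp
    simp only [Finset.coe_filter, Finset.mem_univ, true_and, Set.mem_ofPred_eq] at hp
    simp only [Finset.coe_erase, Finset.coe_filter, Finset.mem_univ, true_and]
    split_ifs with hl
    · refine ⟨⟨hl, by simpa [ht] using hp.2⟩, ?_⟩
      rintro e
      simp only [Set.mem_singleton_iff, Prod.mk.injEq] at e
      have h1 : i = b := t.injective (e.1.trans (Equiv.swap_apply_right a b).symm)
      have h2 : j = a := t.injective (e.2.trans (Equiv.swap_apply_left a b).symm)
      rw [h1, h2] at hp
      exact absurd hp.1 hab.not_gt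
    · rw [not_lt] at hl
      simp only [ht, Equiv.swap_apply_def] at hl
      refine ⟨⟨hp.1, ?_⟩, ?_⟩
      · simp only [ht, Equiv.Perm.mul_apply, Equiv.swap_apply_def]
        grind
      · grind
  · rintro ⟨i, j⟩ hp ⟨i', j'⟩ hp' e
    simp only [Finset.coe_filter, Finset.mem_univ, true_and, Set.mem_ofPred_eq] at hp hp'
    have hi : ∀ i, t (t i) = i := Equiv.swap_apply_self a b
    dsimp only at e
    split_ifs at e with h1 h2 h2
    · simpa using e
    · simp only [Prod.mk.injEq] at e
      rw [← e.1, ← e.2, hi, hi] at h2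
      exact absurd hp.1 h2
    · simp only [Prod.mk.injEq] at e
      rw [e.1, e.2, hi, hi] at h1
      exact absurd hp'.1 h1
    · exact e

theorem BruhatLE.permLength_le {x y : Equiv.Perm (Fin k)} (h : BruhatLE x y) :
    permLength x ≤ permLength y := by
  induction h with
  | refl => exact le_rfl
  | tail _ h ih => exact ih.trans h.2.le

theorem bruhatLT_mul_swap (x : Equiv.Perm (Fin k)) {a b : Fin k} (hab : a < b)
    (h : x a < x b) : BruhatLT x (x * Equiv.swap a b) := by
  have := permLength_lt_mul_swap x hab h
  exact ⟨Relation.ReflTransGen.single ⟨⟨a, b, hab.ne, rfl⟩, this⟩, fun e => this.ne (congrArg _ e)⟩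

theorem BruhatLT.trans {x y z : Equiv.Perm (Fin k)} (h : BruhatLT x y) (h' : BruhatLT y z) :
    BruhatLT x z := by
  refine ⟨Relation.ReflTransGen.trans h.1 h'.1, ?_⟩
  rintro rfl
  obtain ⟨c, ⟨-, hc⟩, hcy⟩ := (Relation.ReflTransGen.cases_head h.1).resolve_left h.2
  exact absurd (hc.trans_le ((BruhatLE.permLength_le hcy).trans (BruhatLE.permLength_le h'.1)))
    (lt_irrefl _)

/-- A cover in the Bruhat order exchanges two values between which no value is in between. -/
theorem exists_swap_of_bruhat_cover {x y : Equiv.Perm (Fin k)} (h : BruhatLT x y)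
    (hcov : ∀ z, ¬ (BruhatLT x z ∧ BruhatLT z y)) :
    ∃ a b : Fin k, a < b ∧ x a < x b ∧ y = x * Equiv.swap a b ∧
      ∀ c, a < c → c < b → x a < x c → ¬ x c < x b := by
  obtain ⟨z, ⟨⟨a, b, hab, hz⟩, hl⟩, hzy⟩ :=
    (Relation.ReflTransGen.cases_head h.1).resolve_left h.2
  have hxz : BruhatLT x z :=
    ⟨Relation.ReflTransGen.single ⟨⟨a, b, hab, hz⟩, hl⟩, fun e => hl.ne (congrArg _ e)⟩
  obtain rfl : z = y := by
    by_contra hne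
    exact hcov z ⟨hxz, hzy, hne⟩
  have key : ∃ a b : Fin k, a < b ∧ z = x * Equiv.swap a b := by
    rcases lt_or_gt_of_ne hab with h1 | h1
    · exact ⟨a, b, h1, hz⟩
    · exact ⟨b, a, h1, by rw [hz, Equiv.swap_comm]⟩
  clear hz hab a b
  obtain ⟨a, b, hab, rfl⟩ := key
  have hx : x a < x b := by
    by_contra hn
    have hn' := lt_of_le_of_ne (not_lt.1 hn) (x.injective.ne hab.ne')
    have := permLength_lt_mul_swap (x * Equiv.swap a b) hab (by simpa using hn')
    rw [mul_assoc, Equiv.swap_mul_self, mul_one] at this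
    exact absurd hl this.not_gt
  refine ⟨a, b, hab, hx, rfl, fun c hac hcb h1 h2 => ?_⟩
  -- With an intermediate value at `c`, (a b) = (a c)(a b)(c b), and each of the three factors
  -- increases the length, contradicting the cover.
  refine hcov (x * Equiv.swap a c) ⟨bruhatLT_mul_swap x hac h1, ?_⟩
  have e1 : x * Equiv.swap a b =
      x * Equiv.swap a c * Equiv.swap a b * Equiv.swap c b := by
    ext i
    simp only [Equiv.Perm.mul_apply, Equiv.swap_apply_def]
    grind
  rw [e1]
  refine (bruhatLT_mul_swap _ hab ?_).trans (bruhatLT_mul_swap _ hcb ?_)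
  · simp only [Equiv.Perm.mul_apply, Equiv.swap_apply_def]
    grind
  · simp only [Equiv.Perm.mul_apply, Equiv.swap_apply_def]
    grind

end BruhatCover

/-! ### Dimension counts for flags in a Richardson variety. -/

namespace CompleteFlag

variable {k : ℕ}

theorem inv_mulVec_mem_standard {M : Matrix.GeneralLinearGroup (Fin k) ℂ} {i : Fin (k + 1)}
    {f : Fin k → ℂ} (h : f ∈ (ofMatrix M).subspace i) :
    (M⁻¹).val.mulVec f ∈ (ofMatrix (1 : Matrix.GeneralLinearGroup (Fin k) ℂ)).subspace i := by
  rw [← inv_mul_cancel M, ← act_ofMatrix]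
  exact ⟨f, h, rfl⟩

/-- In the basis of columns of x σ, the vector e_{σ(j)} has as `j`-th coordinate a diagonal entry of
x⁻¹, which is nonzero. -/
theorem lt_of_single_mem {σ τ : Equiv.Perm (Fin k)} {x : Matrix.GeneralLinearGroup (Fin k) ℂ}
    (hx : x ∈ borelSubgroup τ) {i : Fin (k + 1)} {j : Fin k}
    (h : Pi.single (σ j) 1 ∈ (ofMatrix (x * permGL σ)).subspace i) : (j : ℕ) < i := by
  by_contra hn
  have h1 := apply_eq_zero_of_mem_standard (inv_mulVec_mem_standard h) (not_lt.1 hn)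
  rw [Matrix.mulVec_single_one, mul_inv_rev, ← permGL_inv, Matrix.col_apply] at h1
  have h2 := permGL_mul_apply x⁻¹ σ⁻¹ (σ j) (σ j)
  rw [show σ⁻¹ (σ j) = j by simp] at h2
  rw [h2] at h1
  exact borel_diag_ne_zero (inv_mem hx) _ h1

/-- The vectors whose coordinates in `S` vanish. -/
def vanishing (S : Set (Fin k)) : Submodule ℂ (Fin k → ℂ) where
  carrier := {f | ∀ s ∈ S, f s = 0}
  add_mem' := fun ha hb s hs => by simp [ha s hs, hb s hs]
  zero_mem' := fun _ _ => rfl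
  smul_mem' := fun c f hf s hs => by simp [hf s hs]

/-- The selected columns of x σ are independent, and triangularity makes them vanish on `S`. -/
theorem card_le_finrank_inf_vanishing {σ τ : Equiv.Perm (Fin k)}
    {x : Matrix.GeneralLinearGroup (Fin k) ℂ} (hx : x ∈ borelSubgroup τ) (i : Fin (k + 1))
    {S : Set (Fin k)} (P : Fin k → Prop) [DecidablePred P]
    (hP : ∀ j, P j → ∀ s ∈ S, τ (σ j) < τ s) :
    (Finset.univ.filter fun j : Fin k => (j : ℕ) < i ∧ P j).card ≤
      Module.finrank ℂ ↥((ofMatrix (x * permGL σ)).subspace i ⊓ vanishing S) := by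
  have hli := (Matrix.linearIndependent_cols_of_isUnit (x * permGL σ).isUnit).comp
    (Subtype.val : {j : Fin k // (j : ℕ) < i ∧ P j} → Fin k) Subtype.val_injective
  have h := finrank_span_eq_card hli
  rw [Fintype.card_subtype] at h
  rw [← h]
  refine Submodule.finrank_mono (Submodule.span_le.2 ?_)
  rintro _ ⟨⟨j, hj, hPj⟩, rfl⟩
  refine ⟨col_mem_ofMatrix _ hj, fun s hs => ?_⟩
  change (x * permGL σ).val s j = 0
  rw [mul_permGL_apply]
  exact hx (hP j hPj s hs)

/-- If the positions of a flag relative to the standard and the antistandard flags are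
complementary at `i` and `m`, the `i`-th term of the flag splits along the first `m` coordinates. -/
theorem truncate_mem {F : CompleteFlag k} {u w : Equiv.Perm (Fin k)} (hF : F ∈ Richardson u w)
    {i : Fin (k + 1)} {m : ℕ}
    (hc : (Finset.univ.filter fun j : Fin k => (j : ℕ) < i ∧ (u j : ℕ) < m).card =
      (Finset.univ.filter fun j : Fin k => (j : ℕ) < i ∧ (w j : ℕ) < m).card)
    {f : Fin k → ℂ} (hf : f ∈ F.subspace i) :
    (fun s : Fin k => if (s : ℕ) < m then f s else 0) ∈ F.subspace i := by
  obtain ⟨⟨x, hx, h1⟩, y, hy, h2⟩ := Richardson.mem_iff.1 hF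
  have hA := card_le_finrank_inf_vanishing (σ := w) hx i (S := {s | m ≤ (s : ℕ)})
    (fun j => (w j : ℕ) < m) fun j hj s hs => Fin.lt_def.2 (lt_of_lt_of_le hj hs)
  have hB := card_le_finrank_inf_vanishing (σ := u) hy i (S := {s | (s : ℕ) < m})
    (fun j => ¬ (u j : ℕ) < m) fun j hj s hs => by
      simp only [longest, Fin.revPerm_apply, Fin.rev_lt_rev]
      exact Fin.lt_def.2 (lt_of_lt_of_le hs (not_lt.1 hj))
  rw [← h1] at hA
  rw [← h2] at hB
  set A := F.subspace i ⊓ vanishing {s | m ≤ (s : ℕ)}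
  set B := F.subspace i ⊓ vanishing {s | (s : ℕ) < m}
  have hAB : A ⊓ B = ⊥ := by
    rw [eq_bot_iff]
    rintro g ⟨⟨-, ha⟩, -, hb⟩
    rw [Submodule.mem_bot]
    funext s
    rcases lt_or_ge (s : ℕ) m with h | h
    · exact hb s h
    · exact ha s h
  have hdim := Submodule.finrank_sup_add_finrank_inf_eq A B
  rw [hAB, finrank_bot, add_zero] at hdim
  have hcard : (Finset.univ.filter fun j : Fin k => (j : ℕ) < i ∧ (u j : ℕ) < m).card +
      (Finset.univ.filter fun j : Fin k => (j : ℕ) < i ∧ ¬ (u j : ℕ) < m).card = i := by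
    rw [← Finset.filter_filter, ← Finset.filter_filter, Finset.card_filter_add_card_filter_not,
      Fin.card_filter_val_lt, min_eq_right (Nat.lt_succ_iff.1 i.2)]
  -- The upper representative bounds the dimension of `A` below by a count for `w`, the lower one
  -- that of `B` by the complementary count for `u`. Equality of the counts makes the sum at least
  -- `i`.
  have hsup : A ⊔ B = F.subspace i := by
    refine Submodule.eq_of_le_of_finrank_le (sup_le inf_le_left inf_le_left) ?_
    rw [F.finrank_eq, hdim]
    omega
  rw [← hsup] at hf
  obtain ⟨α, ha, β, hb, rfl⟩ := Submodule.mem_sup.1 hf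
  have h : (fun s : Fin k => if (s : ℕ) < m then (α + β) s else 0) = α := by
    funext s
    split_ifs with h
    · rw [Pi.add_apply, hb.2 s h, add_zero]
    · exact (ha.2 s (not_lt.1 h)).symm
  rw [h]
  exact ha.1

end CompleteFlag

/-! ### Elementary matrices. -/

section Transvection

variable {k : ℕ}

/-- The elementary matrix `1 + t E_{pq}`. -/
noncomputable def transvectionGL {p q : Fin k} (h : p ≠ q) (t : ℂ) :
    Matrix.GeneralLinearGroup (Fin k) ℂ :=
  Matrix.GeneralLinearGroup.mkOfDetNeZero (Matrix.transvection p q t) (by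
    rw [Matrix.det_transvection_of_ne _ _ h]
    exact one_ne_zero)

theorem transvectionGL_val {p q : Fin k} (h : p ≠ q) (t : ℂ) :
    (transvectionGL h t).val = 1 + Matrix.single p q t := rfl

theorem transvectionGL_apply_self {p q : Fin k} (h : p ≠ q) (t : ℂ) :
    (transvectionGL h t).val p q = t := by
  simp [transvectionGL_val, Matrix.one_apply_ne h]

theorem transvectionGL_mem_unipotentSubgroup {p q : Fin k} (h : p ≠ q) (t : ℂ)
    {σ : Equiv.Perm (Fin k)} (hσ : σ p < σ q) :
    transvectionGL h t ∈ unipotentSubgroup σ := by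
  constructor
  · intro i j hij
    have h1 : i ≠ j := by
      rintro rfl
      exact lt_irrefl _ hij
    have h2 : ¬ (p = i ∧ q = j) := by
      rintro ⟨rfl, rfl⟩
      exact hij.not_gt hσ
    rw [transvectionGL_val, Matrix.add_apply, Matrix.one_apply_ne h1, Matrix.single_apply,
      if_neg h2, add_zero]
  · intro i
    have h2 : ¬ (p = i ∧ q = i) := by
      rintro ⟨rfl, rfl⟩
      exact h rfl
    rw [transvectionGL_val, Matrix.add_apply, Matrix.one_apply_eq, Matrix.single_apply,
      if_neg h2, add_zero]

theorem transvectionGL_mul_permGL_col {p q : Fin k} (h : p ≠ q) (t : ℂ) (w : Equiv.Perm (Fin k))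
    (j : Fin k) : (transvectionGL h t * permGL w).val.col j =
      Pi.single (w j) 1 + if w j = q then Pi.single p t else 0 := by
  ext s
  rw [Matrix.col_apply, mul_permGL_apply, transvectionGL_val, Matrix.add_apply, Pi.add_apply,
    Matrix.one_apply, Matrix.single_apply, Pi.single_apply]
  congr 1
  split_ifs with h1 h2 h2
  · simp [h1.1]
  · exact absurd h1.2.symm h2
  · have : s ≠ p := fun e => h1 ⟨e.symm, h2.symm⟩
    simp [this]
  · rfl

end Transvection

/-! ### The open Richardson variety of a Bruhat cover is ℂ^×. -/

namespace Richardson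

variable {k : ℕ} {u : Equiv.Perm (Fin k)} {a b : Fin k}

open CompleteFlag SpaceWithFunctions

/-- The transposition preserves the set of the first `i` positions, so it matches the two counts. -/
theorem card_eq_of_position (hab : a < b) {i : Fin (k + 1)} (hi : (i : ℕ) ≤ a ∨ (b : ℕ) < i)
    (m : ℕ) : (Finset.univ.filter fun j : Fin k => (j : ℕ) < i ∧ (u j : ℕ) < m).card =
      (Finset.univ.filter fun j : Fin k =>
        (j : ℕ) < i ∧ ((u * Equiv.swap a b) j : ℕ) < m).card := by
  refine Finset.card_equiv (Equiv.swap a b) fun j => ?_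
  rw [Finset.mem_filter_univ, Finset.mem_filter_univ, Equiv.Perm.mul_apply, Equiv.swap_apply_self]
  refine and_congr_left fun _ => ?_
  rw [Equiv.swap_apply_def]
  rw [Fin.lt_def] at hab
  split_ifs with h1 h2
  · subst h1
    omega
  · subst h2
    omega
  · rfl

theorem card_eq_of_value (hu : u a < u b) {m : ℕ} (hm : m ≤ u a ∨ (u b : ℕ) < m)
    (i : Fin (k + 1)) : (Finset.univ.filter fun j : Fin k => (j : ℕ) < i ∧ (u j : ℕ) < m).card =
      (Finset.univ.filter fun j : Fin k =>
        (j : ℕ) < i ∧ ((u * Equiv.swap a b) j : ℕ) < m).card := by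
  congr 1
  refine Finset.filter_congr fun j _ => and_congr_right fun _ => ?_
  rw [Equiv.Perm.mul_apply, Equiv.swap_apply_def]
  rw [Fin.lt_def] at hu
  split_ifs with h1 h2
  · subst h1
    omega
  · subst h2
    omega
  · rfl

/-- Truncations at `s` and at `s + 1` differ exactly by the coordinate `s`. -/
theorem single_mem_of_splits {u w : Equiv.Perm (Fin k)} {F : CompleteFlag k}
    (hF : F ∈ Richardson u w) {i : Fin (k + 1)} {s : Fin k}
    (hc : ∀ m, m = (s : ℕ) ∨ m = s + 1 →
      (Finset.univ.filter fun j : Fin k => (j : ℕ) < i ∧ (u j : ℕ) < m).card =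
      (Finset.univ.filter fun j : Fin k => (j : ℕ) < i ∧ (w j : ℕ) < m).card)
    {f : Fin k → ℂ} (hf : f ∈ F.subspace i) : Pi.single s (f s) ∈ F.subspace i := by
  have h1 := truncate_mem hF (hc s (Or.inl rfl)) hf
  have h2 := truncate_mem hF (hc (s + 1) (Or.inr rfl)) hf
  convert sub_mem h2 h1 using 1
  ext r
  rw [Pi.sub_apply, Pi.single_apply]
  rcases lt_trichotomy r s with h | rfl | h
  · have h' := Fin.lt_def.1 h
    rw [if_neg h.ne, if_pos (by omega), if_pos h', sub_self]
  · simp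
  · have h' := Fin.lt_def.1 h
    rw [if_neg h.ne', if_neg (by omega), if_neg (by omega), sub_self]

theorem single_one_mem_of_splits {u w : Equiv.Perm (Fin k)} {F : CompleteFlag k}
    (hF : F ∈ Richardson u w) {i : Fin (k + 1)} {j : Fin k} (hj : (j : ℕ) < i)
    (hc : ∀ m, m = (u j : ℕ) ∨ m = u j + 1 →
      (Finset.univ.filter fun j : Fin k => (j : ℕ) < i ∧ (u j : ℕ) < m).card =
      (Finset.univ.filter fun j : Fin k => (j : ℕ) < i ∧ (w j : ℕ) < m).card) :
    Pi.single (u j) 1 ∈ F.subspace i := by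
  obtain ⟨y, hy, e⟩ := (mem_iff.1 hF).2
  have h1 := col_mem_ofMatrix (y * permGL u) hj
  rw [← e] at h1
  have h2 := single_mem_of_splits hF hc h1
  rw [Matrix.col_apply, mul_permGL_apply] at h2
  have h3 := Submodule.smul_mem _ (y.val (u j) (u j))⁻¹ h2
  rwa [← Pi.single_smul, smul_eq_mul, inv_mul_cancel₀ (borel_diag_ne_zero hy _)] at h3

/-- The flags of the open Richardson variety of a Bruhat cover form a one-parameter family. -/
theorem exists_eq_transvection (hab : a < b) (hu : u a < u b)
    (hcov : ∀ c, a < c → c < b → u a < u c → ¬ u c < u b) {F : CompleteFlag k}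
    (hF : F ∈ Richardson u (u * Equiv.swap a b)) :
    ∃ t : ℂ, t ≠ 0 ∧
      ofMatrix (transvectionGL hu.ne t * permGL (u * Equiv.swap a b)) = F := by
  obtain ⟨⟨x, hx, ex⟩, y, hy, ey⟩ := mem_iff.1 hF
  obtain ⟨x, hx, -, ex'⟩ : ∃ x' ∈ unipotentSubgroup (longest k * (u * Equiv.swap a b)⁻¹),
      x' ∈ borelSubgroup (1 : Equiv.Perm (Fin k)) ∧
      ofMatrix (x' * permGL (u * Equiv.swap a b)) = F := by
    rw [ex]
    exact exists_unipotent_of_borel hx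
  have hab' := Fin.lt_def.1 hab
  have hu' := Fin.lt_def.1 hu
  have hsingle : ∀ j, j ≠ a → j ≠ b → Pi.single (u j) 1 ∈ F.subspace j.succ := by
    intro j hja hjb
    have hja' : (j : ℕ) ≠ a := fun e => hja (Fin.ext e)
    have hjb' : (j : ℕ) ≠ b := fun e => hjb (Fin.ext e)
    refine single_one_mem_of_splits hF (by simp) fun m hm => ?_
    by_cases hj : (j : ℕ) < a ∨ (b : ℕ) < j
    · refine card_eq_of_position hab ?_ m
      rw [Fin.val_succ]
      omega
    -- Here a < j < b, so the cover condition puts `u j` outside the interval of values from `u a`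
    -- to `u b`.
    · refine card_eq_of_value hu ?_ _
      have h1 := hcov j (Fin.lt_def.2 (by omega)) (Fin.lt_def.2 (by omega))
      have h2 : (u j : ℕ) ≠ u a := fun e => hja (u.injective (Fin.ext e))
      have h3 : (u j : ℕ) ≠ u b := fun e => hjb (u.injective (Fin.ext e))
      rw [Fin.lt_def, Fin.lt_def] at h1
      omega
  have hb : Pi.single (u a) 1 ∈ F.subspace b.succ :=
    single_one_mem_of_splits hF (by rw [Fin.val_succ]; omega) fun m _ =>
      card_eq_of_position hab (Or.inr (by simp)) m
  have hcol := col_mem_ofMatrix (x * permGL (u * Equiv.swap a b)) (i := a.succ) (j := a) (by simp)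
  rw [ex'] at hcol
  set f := (x * permGL (u * Equiv.swap a b)).val.col a with hf
  have hfq : f (u b) = 1 := by
    rw [hf, Matrix.col_apply, mul_permGL_apply]
    simpa using hx.2 (u b)
  have hcomp : ∀ j, j ≠ a → j ≠ b → Pi.single (u j) (f (u j)) ∈ F.subspace a.succ := by
    intro j hja hjb
    have hja' : (j : ℕ) ≠ a := fun e => hja (Fin.ext e)
    have hjb' : (j : ℕ) ≠ b := fun e => hjb (Fin.ext e)
    have h2 : (u j : ℕ) ≠ u a := fun e => hja (u.injective (Fin.ext e))
    have h3 : (u j : ℕ) ≠ u b := fun e => hjb (u.injective (Fin.ext e))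
    by_cases hv : (u j : ℕ) < u a ∨ (u b : ℕ) < u j
    · exact single_mem_of_splits hF (fun m hm => card_eq_of_value hu (by omega) _) hcol
    rcases lt_or_gt_of_ne hja' with h | h
    · have := F.mono (Fin.le_def.2 (by simp only [Fin.val_succ]; omega) : j.succ ≤ a.succ)
        (hsingle j hja hjb)
      simpa [← Pi.single_smul] using Submodule.smul_mem _ (f (u j)) this
    · have hbj : (b : ℕ) < j := by
        have h1 := hcov j (Fin.lt_def.2 h)
        rw [Fin.lt_def, Fin.lt_def, Fin.lt_def] at h1
        omega
      have h1 : Pi.single (u j) (f (u j)) ∈ F.subspace b.succ :=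
        single_mem_of_splits hF
          (fun m _ => card_eq_of_position hab (Or.inr (by simp)) m)
          (F.mono (Fin.le_def.2 (by simp only [Fin.val_succ]; omega)) hcol)
      -- A nonzero coordinate would put e_{u j} in the term of dimension b + 1, but j > b.
      have h0 : f (u j) = 0 := by
        by_contra h0
        have h4 := Submodule.smul_mem _ (f (u j))⁻¹ h1
        rw [← Pi.single_smul, smul_eq_mul, inv_mul_cancel₀ h0, ey] at h4
        have := lt_of_single_mem hy h4
        rw [Fin.val_succ] at this
        omega
      rw [h0, Pi.single_zero]
      exact zero_mem _
  have hsum : f = Pi.single (u b) 1 + Pi.single (u a) (f (u a)) +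
      ∑ j ∈ (Finset.univ.erase a).erase b, Pi.single (u j) (f (u j)) := by
    let g : Fin k → Fin k → ℂ := fun j => Pi.single (u j) (f (u j))
    have h1 : f = ∑ j, g j := by
      simp only [g]
      rw [Equiv.sum_comp u fun s => Pi.single s (f s), Finset.univ_sum_single]
    rw [← hfq]
    change f = g b + g a + ∑ j ∈ (Finset.univ.erase a).erase b, g j
    rw [add_comm (g b), add_assoc, Finset.add_sum_erase _ g (by simp [hab.ne']),
      Finset.add_sum_erase _ g (by simp), ← h1]
  have hvec : Pi.single (u b) 1 + Pi.single (u a) (f (u a)) ∈ F.subspace a.succ := by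
    rw [eq_sub_of_add_eq hsum.symm]
    refine sub_mem hcol (sum_mem fun j hj => ?_)
    simp only [Finset.mem_erase, Finset.mem_univ, and_true] at hj
    exact hcomp j hj.2 hj.1
  -- With all other coordinates removed, e_{u b} + f(u a) e_{u a} spans the new direction at `a`. If
  -- f(u a) vanished, e_{u b} would lie in the term of dimension a + 1, forcing b ≤ a.
  refine ⟨f (u a), fun h0 => ?_, ofMatrix_eq_of_cols fun j => ?_⟩
  · rw [h0, Pi.single_zero, add_zero, ey] at hvec
    have := lt_of_single_mem hy hvec
    rw [Fin.val_succ] at this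
    omega
  · rw [transvectionGL_mul_permGL_col, Equiv.Perm.mul_apply]
    rcases eq_or_ne j a with rfl | hja
    · simpa using hvec
    rcases eq_or_ne j b with rfl | hjb
    · simpa [hu.ne] using hb
    · rw [Equiv.swap_apply_of_ne_of_ne hja hjb, if_neg (u.injective.ne hjb), add_zero]
      exact hsingle j hja hjb

theorem transvection_mem_richardson (hab : a < b) (hu : u a < u b) {t : ℂ} (ht : t ≠ 0) :
    ofMatrix (transvectionGL hu.ne t * permGL (u * Equiv.swap a b)) ∈
      Richardson u (u * Equiv.swap a b) := by
  refine mem_iff.2 ⟨⟨_, (transvectionGL_mem_unipotentSubgroup hu.ne t (σ := 1) hu).1, rfl⟩,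
    -- Rescaling e_{u b} + t e_{u a} by t⁻¹ gives e_{u a} + t⁻¹ e_{u b}, the column of a lower
    -- triangular representative over `u`.
    transvectionGL hu.ne' t⁻¹, (transvectionGL_mem_unipotentSubgroup hu.ne' _ ?_).1, ?_⟩
  · simpa [longest] using hu
  symm
  set M := transvectionGL hu.ne t * permGL (u * Equiv.swap a b) with hM
  have hcol : ∀ j, M.val.col j ∈ (ofMatrix M).subspace j.succ := fun j =>
    col_mem_ofMatrix M (by simp)
  have ha := hcol a
  have hb := hcol b
  rw [hM, transvectionGL_mul_permGL_col, ← hM] at ha hb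
  simp only [Equiv.Perm.mul_apply, Equiv.swap_apply_left, Equiv.swap_apply_right, if_true,
    if_neg hu.ne, add_zero] at ha hb
  refine ofMatrix_eq_of_cols fun j => ?_
  rw [transvectionGL_mul_permGL_col]
  rcases eq_or_ne j a with rfl | hja
  · have := Submodule.smul_mem _ t⁻¹ ha
    rw [smul_add, ← Pi.single_smul, ← Pi.single_smul, smul_eq_mul, smul_eq_mul, mul_one,
      inv_mul_cancel₀ ht, add_comm] at this
    rwa [if_pos rfl]
  rcases eq_or_ne j b with rfl | hjb
  · rw [if_neg hu.ne', add_zero]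
    have h1 := (ofMatrix M).mono (Fin.succ_le_succ_iff.2 hab.le) ha
    have h2 := sub_mem h1 (Submodule.smul_mem _ t hb)
    rwa [← Pi.single_smul, smul_eq_mul, mul_one, add_sub_cancel_right] at h2
  · have := hcol j
    rw [hM, transvectionGL_mul_permGL_col, ← hM, Equiv.Perm.mul_apply,
      Equiv.swap_apply_of_ne_of_ne hja hjb, if_neg (u.injective.ne hjb)] at this
    rwa [if_neg (u.injective.ne hja)]

theorem chart_transvection (hab : a < b) (hu : u a < u b) (t : ℂ) :
    chart (u * Equiv.swap a b)
      (ofMatrix (transvectionGL hu.ne t * permGL (u * Equiv.swap a b))) =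
      transvectionGL hu.ne t := by
  refine chart_ofMatrix (transvectionGL_mem_unipotentSubgroup _ _ ?_)
  simpa [longest] using hab

theorem regAt_multiplicativeGroup_val (t : ℂˣ) :
    multiplicativeGroup.RegAt t fun t => (t : ℂ) :=
  ⟨fun p => p (), regAt_affine_apply _ _, EventuallyEq.rfl⟩

/-- The open Richardson variety of a Bruhat cover is isomorphic to `ℂ^×`. -/
theorem exists_isIsomorphism_of_cover (hab : a < b) (hu : u a < u b)
    (hcov : ∀ c, a < c → c < b → u a < u c → ¬ u c < u b) :
    ∃ φ : ℂˣ ≃ Richardson u (u * Equiv.swap a b),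
      IsIsomorphism multiplicativeGroup (variety u (u * Equiv.swap a b)) φ := by
  have hne : ∀ F : Richardson u (u * Equiv.swap a b),
      (chart (u * Equiv.swap a b) F.1).val (u a) (u b) ≠ 0 := by
    rintro ⟨F, hF⟩
    obtain ⟨t, ht, rfl⟩ := exists_eq_transvection hab hu hcov hF
    rwa [chart_transvection hab hu, transvectionGL_apply_self]
  refine ⟨⟨fun t => ⟨_, transvection_mem_richardson hab hu t.ne_zero⟩,
    fun F => Units.mk0 _ (hne F), fun t => ?_, ?_⟩, ?_, ?_⟩
  · ext
    simp only [Units.val_mk0]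
    rw [chart_transvection hab hu, transvectionGL_apply_self]
  · rintro ⟨F, hF⟩
    obtain ⟨t, ht, rfl⟩ := exists_eq_transvection hab hu hcov hF
    apply Subtype.ext
    simp only [Units.val_mk0]
    rw [chart_transvection hab hu, transvectionGL_apply_self]
  · refine isMorphism_mk (M := fun t : ℂˣ =>
      transvectionGL hu.ne (t : ℂ) * permGL (u * Equiv.swap a b)) (fun t => ?_) _
    refine MatrixRegAt.units_mul (B := fun _ => permGL (u * Equiv.swap a b)) (fun i j => ?_)
      (MatrixRegAt.const _)
    simp only [transvectionGL_val, Matrix.add_apply, Matrix.single_apply]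
    refine multiplicativeGroup.add' t _ _ (multiplicativeGroup.const' t _) ?_
    split_ifs
    · exact regAt_multiplicativeGroup_val t
    · exact multiplicativeGroup.const' t _
  · refine IsMorphism.induced_lift (isMorphism_affine fun F i => ?_)
    exact MatrixRegAt.comp (isMorphism_val _ _) (matrixRegAt_chart (mem_chartDomain_right F.2)) _ _

theorem exists_isIsomorphism_of_isMaximalBruhatChain {ℓ : ℕ} {v : Fin (ℓ + 1) → Equiv.Perm (Fin k)}
    (hv : IsMaximalBruhatChain v) (i : Fin ℓ) :
    ∃ φ : ℂˣ ≃ Richardson (v i.castSucc) (v i.succ),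
      IsIsomorphism multiplicativeGroup (variety (v i.castSucc) (v i.succ)) φ := by
  obtain ⟨a, b, hab, hu, e, hcov⟩ := exists_swap_of_bruhat_cover (hv i).1 (hv i).2
  rw [e]
  exact exists_isIsomorphism_of_cover hab hu hcov

theorem isMorphism_torus_apply {ℓ : ℕ} (i : Fin ℓ) :
    IsMorphism (torus ℓ) multiplicativeGroup fun t => t i :=
  IsMorphism.induced_lift (isMorphism_affine fun _ _ =>
    ⟨fun p => p i, regAt_affine_apply _ _, EventuallyEq.rfl⟩)

/-- The torus is built as a subspace of affine space, not as an iterated product, so the two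
directions use the universal properties of the product and of affine space. -/
theorem isIsomorphism_piCongrRight {ℓ : ℕ} {v : Fin (ℓ + 1) → Equiv.Perm (Fin k)}
    {φ : ∀ i : Fin ℓ, ℂˣ ≃ Richardson (v i.castSucc) (v i.succ)}
    (hφ : ∀ i : Fin ℓ,
      IsIsomorphism multiplicativeGroup (variety (v i.castSucc) (v i.succ)) (φ i)) :
    IsIsomorphism (torus ℓ) (chainVariety v) (Equiv.piCongrRight φ) := by
  constructor
  · exact IsMorphism.pi_lift fun i => (hφ i).1.comp (isMorphism_torus_apply i)
  · refine IsMorphism.induced_lift (isMorphism_affine fun p i => ?_)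
    have h := (hφ i).2.comp (isMorphism_pi_apply
      (W := fun i : Fin ℓ => Richardson (v i.castSucc) (v i.succ))
      (fun i => variety (v i.castSucc) (v i.succ)) i)
    exact h.2 p _ (regAt_multiplicativeGroup_val _)

end Richardson

theorem corollary1p5 (k ℓ : ℕ) (v : Fin (ℓ + 1) → Equiv.Perm (Fin k))
    (hv : IsMaximalBruhatChain v) :
    (∃ φ : ∀ i : Fin ℓ, ℂˣ ≃ Richardson (v i.castSucc) (v i.succ),
      (∀ i : Fin ℓ, SpaceWithFunctions.IsIsomorphism SpaceWithFunctions.multiplicativeGroup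
        (Richardson.variety (v i.castSucc) (v i.succ)) (φ i)) ∧
      SpaceWithFunctions.IsIsomorphism (SpaceWithFunctions.torus ℓ) (Richardson.chainVariety v)
        (Equiv.piCongrRight φ)) ∧
    ∃ ψ : Richardson.ChainProduct v → Richardson (v 0) (v (Fin.last ℓ)),
      SpaceWithFunctions.IsOpenEmbedding (Richardson.chainVariety v)
        (Richardson.variety (v 0) (v (Fin.last ℓ))) ψ ∧
      Richardson.IsIteratedSplicing v ψ := by
  constructor
  · choose φ hφ using Richardson.exists_isIsomorphism_of_isMaximalBruhatChain hv
    exact ⟨φ, hφ, Richardson.isIsomorphism_piCongrRight hφ⟩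
  · have hΨ := fun i : Fin ℓ => Richardson.isSplicing_splicingMap (v 0) (v i.castSucc) (v i.succ)
    obtain ⟨G, hG, hGo⟩ := Richardson.exists_iteratedSplicing v _ hΨ
    exact ⟨G (Fin.last ℓ), hGo, _, hΨ, G, hG, rfl⟩
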